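/- Let $\Sigma$ be a finite alphabet. Words over $\Sigma$ are viewed as structures on their set of positions, with unary predicates $Q_a$ ($a\in\Sigma$) for the letters, the linear order $<$ and the successor relation $\mathrm{suc}$ on positions. For $m,n\in\mathbb N$ let $\mathrm{FO}^2_{m,n}[<,\mathrm{suc}]$ be the set of first-order sentences over this vocabulary (with equality) that use at most two distinct variables (which may be re-quantified), have quantifier depth at most $n$, and have at most $m$ blocks of alternating quantifiers on every path of their parse tree, where a quantifier in the scope of an odd number of negations counts as its dual. Let $\mathrm{FO}^2_m[<,\mathrm{suc}]=\bigcup_{n\ge m}\mathrm{FO}^2_{m,n}[<,\mathrm{suc}]$. A sentence $\varphi$ separates two languages $K,L\subseteq\Sigma^\star$ if $w\models\varphi$ for all $w\in K$ and $w\not\models\varphi$ for all $w\in L$, or vice versa. **Theorem (alternation hierarchy for $\mathrm{FO}^2[<,\mathrm{suc}]$).** Let $m$ be a positive integer, and let $\Sigma$ be an alphabet with $m+1$ letters. There are a sentence $\varphi_m\in\mathrm{FO}^2_m[<,\mathrm{suc}]$ and two languages $K_m,L_m\subseteq\Sigma^\star$ such that $\varphi_m$ separates $K_m$ and $L_m$,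 but no $\psi\in\mathrm{FO}^2_{m-1}[<,\mathrm{suc}]$ separates $K_m$ and $L_m$. Hence the alternation hierarchy is strict: the class of languages over $\Sigma$ definable by a sentence of $\mathrm{FO}^2_{m-1}[<,\mathrm{suc}]$ is a proper subclass of the class of those definable by a sentence of $\mathrm{FO}^2_m[<,\mathrm{suc}]$. -/

import Mathlib

namespace TwoVar

/-- First-order formulas over words with letters in `A`, with only two variables, `0` and `1`
(the variables `x` and `y` of two-variable logic), which may be quantified again and again.
The atoms are falsity, "position `v` carries the letter `a`", equality, the linear order `<`,
and the successor relation. -/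
inductive Formula (A : Type*) where
  | falsum : Formula A
  | letter (a : A) (v : Fin 2) : Formula A
  | eq (v v' : Fin 2) : Formula A
  | lt (v v' : Fin 2) : Formula A
  | suc (v v' : Fin 2) : Formula A
  | neg (φ : Formula A) : Formula A
  | and (φ ψ : Formula A) : Formula A
  | or (φ ψ : Formula A) : Formula A
  | ex (v : Fin 2) (φ : Formula A) : Formula A
  | all (v : Fin 2) (φ : Formula A) : Formula A

namespace Formula

variable {A : Type*}

/-- Satisfaction in the word `w`, whose positions are `0, …, w.length - 1`, under the assignment
`σ` of positions to the two variables. The quantifiers range over the positions of `w`;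
`suc v v'` says that `v'` is the position immediately after `v`. -/
def Sat (w : List A) : (Fin 2 → ℕ) → Formula A → Prop
  | _, falsum => False
  | σ, letter a v => w[σ v]? = some a
  | σ, eq v v' => σ v = σ v'
  | σ, lt v v' => σ v < σ v'
  | σ, suc v v' => σ v' = σ v + 1
  | σ, neg φ => ¬ Sat w σ φ
  | σ, and φ ψ => Sat w σ φ ∧ Sat w σ ψ
  | σ, or φ ψ => Sat w σ φ ∨ Sat w σ ψ
  | σ, ex v φ => ∃ i < w.length, Sat w (Function.update σ v i) φ
  | σ, all v φ => ∀ i < w.length, Sat w (Function.update σ v i) φ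

/-- The variables that occur free. -/
def freeVars : Formula A → Finset (Fin 2)
  | falsum => ∅
  | letter _ v => {v}
  | eq v v' => {v, v'}
  | lt v v' => {v, v'}
  | suc v v' => {v, v'}
  | neg φ => φ.freeVars
  | and φ ψ => φ.freeVars ∪ ψ.freeVars
  | or φ ψ => φ.freeVars ∪ ψ.freeVars
  | ex v φ => φ.freeVars.erase v
  | all v φ => φ.freeVars.erase v

/-- A sentence is a formula without free variables. -/
def IsSentence (φ : Formula A) : Prop := φ.freeVars = ∅

/-- Quantifier depth. -/
def depth : Formula A → ℕ
  | falsum => 0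
  | letter _ _ => 0
  | eq _ _ => 0
  | lt _ _ => 0
  | suc _ _ => 0
  | neg φ => φ.depth
  | and φ ψ => max φ.depth ψ.depth
  | or φ ψ => max φ.depth ψ.depth
  | ex _ φ => φ.depth + 1
  | all _ φ => φ.depth + 1

/-- The largest number of new quantifier blocks that a path down the parse tree of the formula
opens, when the formula stands below an even (`pos = true`) or odd (`pos = false`) number of
negations, and `last` is the kind of the innermost quantifier above it (`some true`: existential,
`some false`: universal, `none`: there is none). As usual, a quantifier below an odd number of
negations counts as its dual, as it would after pushing all negations to the atoms. -/
def blocksFrom : Bool → Option Bool → Formula A → ℕ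
  | _, _, falsum => 0
  | _, _, letter _ _ => 0
  | _, _, eq _ _ => 0
  | _, _, lt _ _ => 0
  | _, _, suc _ _ => 0
  | pos, last, neg φ => blocksFrom (!pos) last φ
  | pos, last, and φ ψ => max (blocksFrom pos last φ) (blocksFrom pos last ψ)
  | pos, last, or φ ψ => max (blocksFrom pos last φ) (blocksFrom pos last ψ)
  | pos, last, ex _ φ => (if last = some pos then 0 else 1) + blocksFrom pos (some pos) φ
  | pos, last, all _ φ => (if last = some (!pos) then 0 else 1) + blocksFrom pos (some (!pos)) φ

/-- The maximal number of blocks of alternating quantifiers on a path in the parse tree. -/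
def blocks (φ : Formula A) : ℕ := blocksFrom true none φ

/-- A word satisfies a sentence. Both variables start at the first position, which is immaterial
for a sentence, see `sat_congr`. -/
def Models (φ : Formula A) (w : List A) : Prop := Sat w (fun _ => 0) φ

theorem sat_congr (w : List A) (φ : Formula A) (σ τ : Fin 2 → ℕ)
    (h : ∀ v ∈ φ.freeVars, σ v = τ v) : Sat w σ φ ↔ Sat w τ φ := by
  have aux : ∀ (φ : Formula A) (v : Fin 2) (i : ℕ) (σ τ : Fin 2 → ℕ),
      (∀ u ∈ φ.freeVars.erase v, σ u = τ u) →
      ∀ u ∈ φ.freeVars, Function.update σ v i u = Function.update τ v i u := by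
    intro φ v i σ τ h u hu
    by_cases huv : u = v
    · subst huv; simp
    · simpa [huv] using h u (Finset.mem_erase.2 ⟨huv, hu⟩)
  induction φ generalizing σ τ with
  | falsum => exact Iff.rfl
  | letter a v => simp [Sat, h v (by simp [freeVars])]
  | eq v v' => simp [Sat, h v (by simp [freeVars]), h v' (by simp [freeVars])]
  | lt v v' => simp [Sat, h v (by simp [freeVars]), h v' (by simp [freeVars])]
  | suc v v' => simp [Sat, h v (by simp [freeVars]), h v' (by simp [freeVars])]
  | neg φ ih => exact not_congr (ih σ τ h)
  | and φ ψ ih₁ ih₂ =>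
    exact and_congr (ih₁ σ τ fun v hv => h v (Finset.mem_union_left _ hv))
      (ih₂ σ τ fun v hv => h v (Finset.mem_union_right _ hv))
  | or φ ψ ih₁ ih₂ =>
    exact or_congr (ih₁ σ τ fun v hv => h v (Finset.mem_union_left _ hv))
      (ih₂ σ τ fun v hv => h v (Finset.mem_union_right _ hv))
  | ex v φ ih =>
    exact exists_congr fun i => and_congr_right fun _ => ih _ _ (aux φ v i σ τ h)
  | all v φ ih =>
    exact forall_congr' fun i => imp_congr_right fun _ => ih _ _ (aux φ v i σ τ h)

end Formula

/-- The sentences of `FO²_{m,n}[<,suc]`: two variables, quantifier depth at most `n`, and at most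
`m` blocks of alternating quantifiers on every path of the parse tree. -/
def FO2mn (A : Type*) (m n : ℕ) : Set (Formula A) :=
  {φ | φ.IsSentence ∧ φ.blocks ≤ m ∧ φ.depth ≤ n}

/-- `FO²_m[<,suc]`, the union of `FO²_{m,n}[<,suc]` over `n ≥ m`. -/
def FO2m (A : Type*) (m : ℕ) : Set (Formula A) := ⋃ n ≥ m, FO2mn A m n

/-- `φ` separates `K` and `L`: it holds on all of `K` and nowhere on `L`, or vice versa. -/
def Separates {A : Type*} (φ : Formula A) (K L : Set (List A)) : Prop :=
  ((∀ w ∈ K, φ.Models w) ∧ ∀ w ∈ L, ¬ φ.Models w) ∨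
    ((∀ w ∈ L, φ.Models w) ∧ ∀ w ∈ K, ¬ φ.Models w)

/-- The languages over `A` that are defined by a sentence of `FO²_m[<,suc]`. -/
def definable (A : Type*) (m : ℕ) : Set (Set (List A)) :=
  {P | ∃ φ ∈ FO2m A m, P = {w | φ.Models w}}

end TwoVar

/-! For each depth `n` there is a pair of words that differ only in whether the core holds a letter
`1`. Around the core lie shells, alternately on its right and on its left: each step of `nest`
reverses what it has and appends. The shell of level `K` consists of many copies of `K, 1, …, K -
1`, and inside it only letters below `K` occur. The letter `0` pads every other letter widely on
both sides.

Definability: the inside of a shell is what comes before the first `K` (or after the last one), up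
to padding. So being outside needs one quantifier over the negated condition of the previous level,
hence at most one block per shell (`sat_outer`, `blocksFrom_outer`).

Indistinguishability: with two variables, every move is measured from the one pebble that stays, so
a one-pebble game governs the logic (`sat_iff_of_config`). While Spoiler keeps to one word,
Duplicator lives on repetition: a small neighbourhood contains at most one letter, so it recurs in
every copy of a large enough alphabet (`Saturated.sim`).

For more blocks one inducts on the shells (`sim_nest`). By induction Duplicator survives all blocks
but the last while keeping both pebbles inside or at corresponding places outside a middle part.
When the last block starts in the middle, there are many copies of the smaller alphabet on the left,
many of the larger one on the right, and no larger letter on the left. That suffices for one more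
block, wherever the pebbles are in the middle (`Arena.sim_inside`, `Sim.lift`). -/

namespace TwoVar

/-! ### The one-pebble game with a bounded number of blocks -/

/-- The pairs of positions `(i, j)` and `(i', j')` have the same order and successor type. -/
def SameOrder (i j i' j' : ℤ) : Prop :=
  (j + 2 ≤ i ∧ j' + 2 ≤ i') ∨ (-1 ≤ j - i ∧ j - i ≤ 1 ∧ j - i = j' - i') ∨
    (i + 2 ≤ j ∧ i' + 2 ≤ j')

theorem SameOrder.symm {i j i' j' : ℤ} (h : SameOrder i j i' j') : SameOrder i' j' i j := by
  unfold SameOrder at *; omega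

theorem SameOrder.swap {i j i' j' : ℤ} (h : SameOrder i j i' j') : SameOrder j i j' i' := by
  unfold SameOrder at *; omega

/-- Duplicator wins the `n`-round one-pebble game on positions of two words in which Spoiler plays
at most `k` blocks of moves, starting in the first word, if matched positions have to be related
by `R`. -/
def Sim : ℕ → ℕ → (ℤ → ℤ → Prop) → ℤ → ℤ → Prop
  | 0, _, R, i, i' => R i i'
  | _ + 1, 0, R, i, i' => R i i'
  | k + 1, n + 1, R, i, i' => R i i' ∧
      (∀ j, ∃ j', SameOrder i j i' j' ∧ Sim (k + 1) n R j j') ∧ Sim k (n + 1) (flip R) i' i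

theorem Sim.rel {k n : ℕ} {R : ℤ → ℤ → Prop} {i i' : ℤ} (h : Sim k n R i i') : R i i' := by
  cases k with
  | zero => simpa [Sim] using h
  | succ k => cases n with
    | zero => simpa [Sim] using h
    | succ n => rw [Sim] at h; exact h.1

theorem Sim.forth {k n : ℕ} {R : ℤ → ℤ → Prop} {i i' : ℤ} (h : Sim (k + 1) (n + 1) R i i')
    (j : ℤ) : ∃ j', SameOrder i j i' j' ∧ Sim (k + 1) n R j j' := by
  rw [Sim] at h; exact h.2.1 j

/-- Changing the word in which Spoiler plays costs a block but no round, as alternation by itself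
adds no quantifier depth. -/
theorem Sim.switch {k n : ℕ} {R : ℤ → ℤ → Prop} {i i' : ℤ} (h : Sim (k + 1) n R i i') :
    Sim k n (flip R) i' i := by
  cases n with
  | zero => have := h.rel; cases k <;> simpa [Sim, flip] using this
  | succ n => rw [Sim] at h; exact h.2.2

theorem Sim.mono_left {k : ℕ} : ∀ {n : ℕ} {R : ℤ → ℤ → Prop} {i i' : ℤ},
    Sim (k + 1) n R i i' → Sim k n R i i' := by
  induction k with
  | zero => intro n R i i' h; simpa [Sim] using h.rel
  | succ k ihk =>
    intro n
    induction n with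
    | zero => intro R i i' h; simpa [Sim] using h.rel
    | succ n ih =>
      intro R i i' h
      rw [Sim]
      refine ⟨h.rel, fun j => ?_, ihk h.switch⟩
      obtain ⟨j', hj, hs⟩ := h.forth j
      exact ⟨j', hj, ih hs⟩

theorem Sim.mono_right {k : ℕ} : ∀ {n : ℕ} {R : ℤ → ℤ → Prop} {i i' : ℤ},
    Sim k (n + 1) R i i' → Sim k n R i i' := by
  induction k with
  | zero => intro n R i i' h; simpa [Sim] using h.rel
  | succ k ihk =>
    intro n
    induction n with
    | zero => intro R i i' h; simpa [Sim] using h.rel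
    | succ n ih =>
      intro R i i' h
      rw [Sim]
      refine ⟨h.rel, fun j => ?_, ihk h.switch⟩
      obtain ⟨j', hj, hs⟩ := h.forth j
      exact ⟨j', hj, ih hs⟩

theorem Sim.weaken {k : ℕ} : ∀ {n : ℕ} {R S : ℤ → ℤ → Prop} {i i' : ℤ},
    (∀ x y, R x y → S x y) → Sim k n R i i' → Sim k n S i i' := by
  induction k with
  | zero => intro n R S i i' hRS h; simpa [Sim] using hRS _ _ h.rel
  | succ k ihk =>
    intro n
    induction n with
    | zero => intro R S i i' hRS h; simpa [Sim] using hRS _ _ h.rel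
    | succ n ih =>
      intro R S i i' hRS h
      rw [Sim]
      refine ⟨hRS _ _ h.rel, fun j => ?_, ihk (fun x y hxy => hRS _ _ hxy) h.switch⟩
      obtain ⟨j', hj, hs⟩ := h.forth j
      exact ⟨j', hj, ih hRS hs⟩

theorem Sim.one_of_succ {k n : ℕ} {R : ℤ → ℤ → Prop} {i i' : ℤ} (h : Sim (k + 1) n R i i') :
    Sim 1 n R i i' := by
  induction k with
  | zero => exact h
  | succ k ih => exact ih h.mono_left

/-- Reading both words from right to left does not change the game. -/
theorem Sim.reflect {k : ℕ} : ∀ {n : ℕ} {R : ℤ → ℤ → Prop} {a b i i' : ℤ},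
    Sim k n (fun x y => R (a - x) (b - y)) i i' → Sim k n R (a - i) (b - i') := by
  induction k with
  | zero => intro n R a b i i' h; simpa [Sim] using h.rel
  | succ k ihk =>
    intro n
    induction n with
    | zero => intro R a b i i' h; simpa [Sim] using h.rel
    | succ n ih =>
      intro R a b i i' h
      rw [Sim]
      refine ⟨h.rel, fun j => ?_, ihk (R := flip R) h.switch⟩
      obtain ⟨j', hj, hs⟩ := h.forth (a - j)
      refine ⟨b - j', by unfold SameOrder at *; omega, ?_⟩
      have := ih hs
      rwa [sub_sub_cancel] at this

/-- If winning one block for the finer relation `R` lets Duplicator win one block for `S` in either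
direction, then winning `k + 1` blocks for `R` lets her win `k + 2` blocks for `S`. -/
theorem Sim.lift {N : ℕ} : ∀ {k n : ℕ} {R S : ℤ → ℤ → Prop} {i i' : ℤ}, n ≤ N →
    (∀ x y, R x y → S x y) →
    (∀ r ≤ N, ∀ x y, Sim 1 r R x y → Sim 1 r (flip S) y x) →
    (∀ r ≤ N, ∀ x y, Sim 1 r (flip R) y x → Sim 1 r S x y) →
    Sim (k + 1) n R i i' → Sim (k + 2) n S i i' := by
  intro k
  induction k with
  | zero =>
    intro n
    induction n with
    | zero => intro R S i i' _ hRS _ _ h; simpa [Sim] using hRS _ _ h.rel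
    | succ n ih =>
      intro R S i i' hn hRS h1 h2 h
      rw [Sim]
      -- The extra block is spent here, as the last one. The hypothesis needs the whole remaining
      -- game for `R`, since that also matches neighbourhoods.
      refine ⟨hRS _ _ h.rel, fun j => ?_, h1 _ hn _ _ h⟩
      obtain ⟨j', hj, hs⟩ := h.forth j
      exact ⟨j', hj, ih (by omega) hRS h1 h2 hs⟩
  | succ k ihk =>
    intro n
    induction n with
    | zero => intro R S i i' _ hRS _ _ h; simpa [Sim] using hRS _ _ h.rel
    | succ n ih =>
      intro R S i i' hn hRS h1 h2 h
      rw [Sim]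
      refine ⟨hRS _ _ h.rel, fun j => ?_, ihk hn (fun x y hxy => hRS _ _ hxy)
        (fun r hr x y => h2 r hr y x) (fun r hr x y => h1 r hr y x) h.switch⟩
      obtain ⟨j', hj, hs⟩ := h.forth j
      exact ⟨j', hj, ih (by omega) hRS h1 h2 hs⟩

/-- A winning strategy for one block matches the neighbours of the pebbles. -/
theorem Sim.rel_add {n : ℕ} : ∀ {R : ℤ → ℤ → Prop} {i i' : ℤ}, Sim 1 n R i i' →
    ∀ t : ℤ, |t| ≤ n → R (i + t) (i' + t) := by
  induction n with
  | zero =>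
    intro R i i' h t ht
    have : t = 0 := by simpa using ht
    simpa [this] using h.rel
  | succ n ih =>
    intro R i i' h t ht
    push_cast at ht
    rcases lt_trichotomy t 0 with h0 | h0 | h0
    · obtain ⟨j', hj, hs⟩ := h.forth (i - 1)
      have hj' : j' = i' - 1 := by unfold SameOrder at hj; omega
      have := ih hs (t + 1) (by rw [abs_le] at *; omega)
      rw [hj'] at this
      convert this using 1 <;> ring
    · simpa [h0] using h.rel
    · obtain ⟨j', hj, hs⟩ := h.forth (i + 1)
      have hj' : j' = i' + 1 := by unfold SameOrder at hj; omega
      have := ih hs (t - 1) (by rw [abs_le] at *; omega)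
      rw [hj'] at this
      convert this using 1 <;> ring

/-! ### From the game to formulas -/

namespace Formula

variable {A : Type*}

/-- Only the polarity relative to the open block matters, so a universal block can be treated as an
existential one of the dual formula. -/
theorem blocksFrom_dual (φ : Formula A) : ∀ (pos s : Bool),
    blocksFrom (!pos) (some (!s)) φ = blocksFrom pos (some s) φ := by
  induction φ with
  | falsum | letter | eq | lt | suc => intros; rfl
  | neg φ ih => intro pos s; simpa [blocksFrom] using ih (!pos) s
  | and φ ψ ih₁ ih₂ | or φ ψ ih₁ ih₂ => intro pos s; simp [blocksFrom, ih₁, ih₂]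
  | ex v φ ih | all v φ ih =>
    intro pos s
    have h1 := ih true true
    have h2 := ih true false
    simp only [Bool.not_true, Bool.not_false] at h1 h2
    cases pos <;> cases s <;> simp [blocksFrom, h1, h2]

end Formula

/-- The letter at an integer position, `none` outside of the word. -/
def letterAt {A : Type*} (w : List A) (x : ℤ) : Option A := if 0 ≤ x then w[x.toNat]? else none

theorem letterAt_natCast {A : Type*} (w : List A) (i : ℕ) : letterAt w i = w[i]? := by
  simp [letterAt]

/-- Two assignments between which Duplicator wins the game. -/
structure Config (k n : ℕ) (R : ℤ → ℤ → Prop) (σ τ : Fin 2 → ℕ) : Prop where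
  order : SameOrder (σ 0) (σ 1) (τ 0) (τ 1)
  sim : ∀ v, Sim k n R (σ v) (τ v)

theorem Config.order_all {k n : ℕ} {R : ℤ → ℤ → Prop} {σ τ : Fin 2 → ℕ} (h : Config k n R σ τ)
    (v v' : Fin 2) : SameOrder (σ v) (σ v') (τ v) (τ v') := by
  have h₀ := h.order
  have h₁ := h.order.swap
  fin_cases v <;> fin_cases v'
  · simp [SameOrder]
  · exact h₀
  · exact h₁
  · simp [SameOrder]

theorem Config.switch {k n : ℕ} {R : ℤ → ℤ → Prop} {σ τ : Fin 2 → ℕ}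
    (h : Config (k + 1) n R σ τ) : Config k n (flip R) τ σ :=
  ⟨h.order.symm, fun v => (h.sim v).switch⟩

theorem Config.forth {A : Type*} {k n : ℕ} {R : ℤ → ℤ → Prop} {σ τ : Fin 2 → ℕ} {w w' : List A}
    (hR : ∀ x y, R x y → letterAt w x = letterAt w' y) (h : Config (k + 1) (n + 1) R σ τ)
    (v : Fin 2) {i : ℕ} (hi : i < w.length) : ∃ i' < w'.length,
      Config (k + 1) n R (Function.update σ v i) (Function.update τ v i') := by
  -- In `Fin 2`, `v + 1` is the other variable: the new place of `v` is compared only with the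
  -- pebble that stays.
  obtain ⟨j', hj, hs⟩ := (h.sim (v + 1)).forth i
  have hl := hR _ _ hs.rel
  rw [letterAt_natCast, List.getElem?_eq_getElem hi] at hl
  -- The game runs on all integers, but outside of a word the letter is `none`, so a position of `w`
  -- is answered by a position of `w'`.
  have h0 : 0 ≤ j' := by
    by_contra h0
    simp [letterAt, h0] at hl
  lift j' to ℕ using h0
  rw [letterAt_natCast] at hl
  refine ⟨j', (List.getElem?_eq_some_iff.1 hl.symm).1, ?_, ?_⟩
  · fin_cases v
    · simpa using hj.swap
    · simpa using hj
  · intro u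
    by_cases huv : u = v
    · subst huv; simpa using hs
    · simpa [huv] using (h.sim u).mono_right

namespace Formula

variable {A : Type*}

/-- The game has `k + 1` blocks because the open existential block counts as one of them. A
quantifier of the open kind is answered by `forth`; one of the dual kind reverses the direction of
transfer and is paid for by `switch`. The two halves are proved together because negation exchanges
them. -/
theorem sat_of_config (φ : Formula A) : ∀ (k n : ℕ) (R : ℤ → ℤ → Prop) (σ τ : Fin 2 → ℕ)
    (w w' : List A), (∀ x y, R x y → letterAt w x = letterAt w' y) → Config (k + 1) n R σ τ →
    φ.depth ≤ n → (blocksFrom true (some true) φ ≤ k → Sat w σ φ → Sat w' τ φ) ∧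
      (blocksFrom false (some true) φ ≤ k → Sat w' τ φ → Sat w σ φ) := by
  induction φ with
  | falsum => intros; simp [Sat]
  | letter a v =>
    intro k n R σ τ w w' hR h _
    have := hR _ _ (h.sim v).rel
    rw [letterAt_natCast, letterAt_natCast] at this
    simp [Sat, this]
  | eq v v' =>
    intro k n R σ τ w w' hR h _
    have := h.order_all v v'
    unfold SameOrder at this
    simp only [Sat]
    omega
  | lt v v' =>
    intro k n R σ τ w w' hR h _
    have := h.order_all v v'
    unfold SameOrder at this
    simp only [Sat]
    omega
  | suc v v' =>
    intro k n R σ τ w w' hR h _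
    have := h.order_all v v'
    unfold SameOrder at this
    simp only [Sat]
    omega
  | neg φ ih =>
    intro k n R σ τ w w' hR h hd
    have := ih k n R σ τ w w' hR h hd
    exact ⟨fun hb hs ht => hs (this.2 hb ht), fun hb hs ht => hs (this.1 hb ht)⟩
  | and φ ψ ih₁ ih₂ =>
    intro k n R σ τ w w' hR h hd
    simp only [depth, sup_le_iff] at hd
    have h₁ := ih₁ k n R σ τ w w' hR h hd.1
    have h₂ := ih₂ k n R σ τ w w' hR h hd.2
    simp only [blocksFrom, sup_le_iff]
    exact ⟨fun hb hs => ⟨h₁.1 hb.1 hs.1, h₂.1 hb.2 hs.2⟩,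
      fun hb hs => ⟨h₁.2 hb.1 hs.1, h₂.2 hb.2 hs.2⟩⟩
  | or φ ψ ih₁ ih₂ =>
    intro k n R σ τ w w' hR h hd
    simp only [depth, sup_le_iff] at hd
    have h₁ := ih₁ k n R σ τ w w' hR h hd.1
    have h₂ := ih₂ k n R σ τ w w' hR h hd.2
    simp only [blocksFrom, sup_le_iff]
    exact ⟨fun hb hs => hs.imp (h₁.1 hb.1) (h₂.1 hb.2), fun hb hs => hs.imp (h₁.2 hb.1) (h₂.2 hb.2)⟩
  | ex v φ ih =>
    intro k n R σ τ w w' hR h hd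
    obtain ⟨n, rfl⟩ : ∃ l, n = l + 1 := ⟨n - 1, by simp only [depth] at hd; omega⟩
    have hd' : φ.depth ≤ n := by simpa [depth] using hd
    constructor
    · rintro hb ⟨i, hi, hs⟩
      obtain ⟨i', hi', hc⟩ := h.forth hR v hi
      exact ⟨i', hi', (ih k n R _ _ w w' hR hc hd').1 (by simpa [blocksFrom] using hb) hs⟩
    · rintro hb ⟨i, hi, hs⟩
      have hb' : 1 + blocksFrom true (some true) φ ≤ k := by
        have := blocksFrom_dual φ true true
        simp only [Bool.not_true] at this
        simpa [blocksFrom, this] using hb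
      obtain ⟨k, rfl⟩ : ∃ l, k = l + 1 := ⟨k - 1, by omega⟩
      have hR' : ∀ x y, flip R x y → letterAt w' x = letterAt w y := fun x y hxy => (hR _ _ hxy).symm
      obtain ⟨i', hi', hc⟩ := h.switch.forth hR' v hi
      exact ⟨i', hi', (ih k n _ _ _ w' w hR' hc hd').1 (by omega) hs⟩
  | all v φ ih =>
    intro k n R σ τ w w' hR h hd
    obtain ⟨n, rfl⟩ : ∃ l, n = l + 1 := ⟨n - 1, by simp only [depth] at hd; omega⟩
    have hd' : φ.depth ≤ n := by simpa [depth] using hd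
    constructor
    · intro hb hs i hi
      have hb' : 1 + blocksFrom false (some true) φ ≤ k := by
        have := blocksFrom_dual φ false true
        simp only [Bool.not_true, Bool.not_false] at this
        simpa [blocksFrom, this] using hb
      obtain ⟨k, rfl⟩ : ∃ l, k = l + 1 := ⟨k - 1, by omega⟩
      have hR' : ∀ x y, flip R x y → letterAt w' x = letterAt w y := fun x y hxy => (hR _ _ hxy).symm
      obtain ⟨i', hi', hc⟩ := h.switch.forth hR' v hi
      exact (ih k n _ _ _ w' w hR' hc hd').2 (by omega) (hs i' hi')
    · intro hb hs i hi
      obtain ⟨i', hi', hc⟩ := h.forth hR v hi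
      exact (ih k n R _ _ w w' hR hc hd').2 (by simpa [blocksFrom] using hb) (hs i' hi')

/-- Formulas of at most `k` blocks do not distinguish assignments between which Duplicator wins
the game with `k` blocks in both directions. -/
theorem sat_iff_of_config (φ : Formula A) {k n : ℕ} {R : ℤ → ℤ → Prop} {σ τ : Fin 2 → ℕ}
    {w w' : List A} (hR : ∀ x y, R x y → letterAt w x = letterAt w' y) (h : Config k n R σ τ)
    (h' : Config k n (flip R) τ σ) (hd : φ.depth ≤ n) (pos : Bool)
    (hb : blocksFrom pos none φ ≤ k) : Sat w σ φ ↔ Sat w' τ φ := by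
  have hR' : ∀ x y, flip R x y → letterAt w' x = letterAt w y := fun x y hxy => (hR _ _ hxy).symm
  induction φ generalizing pos with
  | falsum => simp [Sat]
  | letter a v =>
    have := hR _ _ (h.sim v).rel
    rw [letterAt_natCast, letterAt_natCast] at this
    simp [Sat, this]
  | eq v v' =>
    have := h.order_all v v'
    unfold SameOrder at this
    simp only [Sat]
    omega
  | lt v v' =>
    have := h.order_all v v'
    unfold SameOrder at this
    simp only [Sat]
    omega
  | suc v v' =>
    have := h.order_all v v'
    unfold SameOrder at this
    simp only [Sat]
    omega
  | neg φ ih => exact not_congr (ih hd _ hb)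
  | and φ ψ ih₁ ih₂ =>
    simp only [depth, blocksFrom, sup_le_iff] at hd hb
    exact and_congr (ih₁ hd.1 _ hb.1) (ih₂ hd.2 _ hb.2)
  | or φ ψ ih₁ ih₂ =>
    simp only [depth, blocksFrom, sup_le_iff] at hd hb
    exact or_congr (ih₁ hd.1 _ hb.1) (ih₂ hd.2 _ hb.2)
  | ex v φ _ =>
    have hb' : 1 + blocksFrom true (some true) φ ≤ k := by
      have := blocksFrom_dual φ true true
      simp only [Bool.not_true] at this
      cases pos <;> simpa [blocksFrom, this] using hb
    obtain ⟨k, rfl⟩ : ∃ l, k = l + 1 := ⟨k - 1, by omega⟩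
    have hb'' : blocksFrom true (some true) (ex v φ) ≤ k := by
      simp only [blocksFrom, if_true]; omega
    exact ⟨(sat_of_config _ k n R σ τ w w' hR h hd).1 hb'',
      (sat_of_config _ k n _ τ σ w' w hR' h' hd).1 hb''⟩
  | all v φ _ =>
    have hb' : 1 + blocksFrom false (some true) φ ≤ k := by
      have := blocksFrom_dual φ false true
      simp only [Bool.not_true, Bool.not_false] at this
      cases pos <;> simpa [blocksFrom, this] using hb
    obtain ⟨k, rfl⟩ : ∃ l, k = l + 1 := ⟨k - 1, by omega⟩
    have hb'' : blocksFrom false (some true) (all v φ) ≤ k := by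
      simp only [blocksFrom, Bool.not_false, if_true]; omega
    exact ⟨(sat_of_config _ k n _ τ σ w' w hR' h' hd).2 hb'',
      (sat_of_config _ k n R σ τ w w' hR h hd).2 hb''⟩

end Formula

/-! ### Full intervals and chains of them -/

/-- The interval `[lo, hi)` contains every letter `1, …, A`, isolated by padding. -/
def Full (n A : ℕ) (g : ℤ → ℕ) (lo hi : ℤ) : Prop :=
  ∀ e, 1 ≤ e → e ≤ A → ∃ z, lo + (3 * n + 3) ≤ z ∧ z + (3 * n + 3) < hi ∧ g z = e ∧
    ∀ t : ℤ, t ≠ 0 → |t| ≤ 3 * n + 3 → g (z + t) = 0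

theorem Full.mono {n A B : ℕ} {g : ℤ → ℕ} {lo hi : ℤ} (h : Full n B g lo hi) (hAB : A ≤ B) :
    Full n A g lo hi :=
  fun e h1 hA => h e h1 (hA.trans hAB)

theorem Full.width {n A : ℕ} {g : ℤ → ℕ} {lo hi : ℤ} (h : Full n A g lo hi) (hA : 1 ≤ A) :
    lo + (6 * n + 6) < hi := by
  obtain ⟨z, h1, h2, -⟩ := h 1 le_rfl hA
  omega

/-- A local pattern with at most one letter, which is at most `A`, occurs in every full interval. -/
theorem Full.exists_match {n A : ℕ} {f g : ℤ → ℕ} {lo hi : ℤ} (h : Full n A g lo hi) (hA : 1 ≤ A)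
    {r : ℕ} (hr : r ≤ n) {j : ℤ}
    (hj : (∀ t : ℤ, |t| ≤ r → f (j + t) = 0) ∨ ∃ e : ℤ, |e| ≤ r ∧ 1 ≤ f (j + e) ∧ f (j + e) ≤ A ∧
      ∀ t : ℤ, |t| ≤ r → t ≠ e → f (j + t) = 0) :
    ∃ z, lo ≤ z ∧ z < hi ∧ ∀ t : ℤ, |t| ≤ r → f (j + t) = g (z + t) := by
  rcases hj with hj | ⟨e, he, h1, h2, h0⟩
  · obtain ⟨z, hz1, hz2, -, hz⟩ := h 1 le_rfl hA
    -- Shifted by `2 * n + 1`, a window of radius at most `n` misses the letter at `z` and stays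
    -- within its padding.
    refine ⟨z + (2 * n + 1), by omega, by omega, fun t ht => ?_⟩
    rw [hj t ht, add_assoc, hz _ (by rw [abs_le] at ht; omega) (by rw [abs_le] at *; omega)]
  · obtain ⟨z, hz1, hz2, hze, hz⟩ := h _ h1 h2
    rw [abs_le] at he
    refine ⟨z - e, by omega, by omega, fun t ht => ?_⟩
    by_cases hte : t = e
    · subst hte; rw [sub_add_cancel, hze]
    · rw [h0 t ht hte, show z - e + t = z + (t - e) by ring,
        hz _ (by omega) (by rw [abs_le] at *; omega)]

/-- The points `y 0, …, y s` of `[0, d]` cut out `s` consecutive full intervals. -/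
structure Chain (n A : ℕ) (g : ℤ → ℕ) (d : ℤ) (s : ℕ) (y : ℕ → ℤ) : Prop where
  nonneg : 0 ≤ y 0
  le : y s ≤ d
  full : ∀ t < s, Full n A g (y t) (y (t + 1))

section Chain

variable {n A : ℕ} {g : ℤ → ℕ} {d : ℤ} {s : ℕ} {y : ℕ → ℤ}

theorem Chain.add_le (h : Chain n A g d s y) (hA : 1 ≤ A) {a : ℕ} : ∀ {b : ℕ}, a < b → b ≤ s →
    y a + (6 * n + 6) < y b := by
  intro b hab hb
  induction b with
  | zero => omega
  | succ b ih =>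
    have hw := (h.full b (by omega)).width hA
    rcases Nat.lt_succ_iff_lt_or_eq.1 hab with hab | rfl
    · have := ih hab (by omega)
      omega
    · exact hw

theorem Chain.le_of_le (h : Chain n A g d s y) (hA : 1 ≤ A) {a b : ℕ} (hab : a ≤ b) (hb : b ≤ s) :
    y a ≤ y b := by
  rcases hab.eq_or_lt with rfl | hab
  · exact le_rfl
  · have := h.add_le hA hab hb
    omega

theorem Chain.sub (h : Chain n A g d s y) (hA : 1 ≤ A) {a s' : ℕ} (has : a + s' ≤ s) :
    Chain n A g d s' (fun t => y (a + t)) where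
  nonneg := h.nonneg.trans (h.le_of_le hA (Nat.zero_le _) (by omega))
  le := (h.le_of_le hA has le_rfl).trans h.le
  full t ht := h.full (a + t) (by omega)

theorem Chain.mono {B : ℕ} (h : Chain n B g d s y) (hAB : A ≤ B) : Chain n A g d s y :=
  ⟨h.nonneg, h.le, fun t ht => (h.full t ht).mono hAB⟩

end Chain

/-- There are `s` full intervals to the left of `x`. -/
def SatL (n A : ℕ) (g : ℤ → ℕ) (d : ℤ) (s : ℕ) (x : ℤ) : Prop :=
  ∃ y, Chain n A g d s y ∧ y s ≤ x

/-- There are `s` full intervals to the right of `x`. -/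
def SatR (n A : ℕ) (g : ℤ → ℕ) (d : ℤ) (s : ℕ) (x : ℤ) : Prop :=
  ∃ y, Chain n A g d s y ∧ x ≤ y 0

/-- Giving up one interval pays for a step to a neighbour, since a full interval has more than `6 *
n + 6` positions. -/
theorem SatL.of_lt {n A : ℕ} {g : ℤ → ℕ} {d : ℤ} {s s' : ℕ} {x x' : ℤ} (h : SatL n A g d s x)
    (hA : 1 ≤ A) (hs : s' < s) (hx : x ≤ x' + 1) : SatL n A g d s' x' := by
  obtain ⟨y, hy, hyx⟩ := h
  have := hy.add_le hA hs le_rfl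
  refine ⟨_, hy.sub hA (a := 0) (s' := s') (by omega), ?_⟩
  simp only [zero_add]
  omega

theorem SatR.of_lt {n A : ℕ} {g : ℤ → ℕ} {d : ℤ} {s s' : ℕ} {x x' : ℤ} (h : SatR n A g d s x)
    (hA : 1 ≤ A) (hs : s' < s) (hx : x' ≤ x + 1) : SatR n A g d s' x' := by
  obtain ⟨y, hy, hyx⟩ := h
  have := hy.add_le hA (a := 0) (b := 1) (by omega) (by omega)
  refine ⟨_, hy.sub hA (a := 1) (s' := s') (by omega), ?_⟩
  simp only [add_zero]
  omega

/-- A number of full intervals that lasts for `r` rounds. -/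
def richness : ℕ → ℕ
  | 0 => 1
  | r + 1 => 2 * richness r + 3

theorem richness_le {r n : ℕ} (h : r ≤ n) : richness r ≤ richness n := by
  induction n with
  | zero => simp [Nat.le_zero.1 h]
  | succ n ih =>
    rcases h.eq_or_lt with rfl | h
    · exact le_rfl
    · have := ih (by omega)
      simp only [richness]; omega

/-! ### Duplicator's strategy for one block -/

/-- Matching positions in two words which agree outside of `[c, d)` and `[c, d')`. -/
def CtxRel (f g : ℤ → ℕ) (c d d' x y : ℤ) : Prop :=
  f x = g y ∧ ((x < c ∧ y = x) ∨ (d ≤ x ∧ y - d' = x - d) ∨ (c ≤ x ∧ x < d ∧ c ≤ y ∧ y < d'))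

theorem CtxRel.symm {f g : ℤ → ℕ} {c d d' x y : ℤ} (h : CtxRel f g c d d' x y) (hcd : c ≤ d) :
    CtxRel g f c d' d y x := by
  unfold CtxRel at *
  exact ⟨h.1.symm, by omega⟩

/-- What Duplicator needs in order to win one block of `n` rounds on words whose letters are at
most `K`, when Spoiler plays in `f`. -/
structure Arena (n K : ℕ) (f g : ℤ → ℕ) (d d' : ℤ) : Prop where
  one_le : 1 ≤ K
  len : 4 * n < d
  len' : 6 * n + 6 ≤ d'
  left : ∀ y : ℤ, y ≤ 2 * n → f y = g y
  right : ∀ t : ℤ, -(2 * n) ≤ t → f (d + t) = g (d' + t)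
  le : ∀ y, 0 ≤ y → y < d → f y ≤ K
  sparse : ∀ (j : ℤ) (r : ℕ), r ≤ n → r ≤ j → j + r < d → (∀ t : ℤ, |t| ≤ r → f (j + t) = 0) ∨
    ∃ e : ℤ, |e| ≤ r ∧ 1 ≤ f (j + e) ∧ ∀ t : ℤ, |t| ≤ r → t ≠ e → f (j + t) = 0

/-- Duplicator's invariant for one block of moves. -/
structure Saturated (n K : ℕ) (f g : ℤ → ℕ) (d d' : ℤ) (A r : ℕ) (x x' : ℤ) : Prop where
  loc : ∀ t : ℤ, |t| ≤ r → f (x + t) = g (x' + t)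
  one_le : 1 ≤ A
  le : A ≤ K
  low : ∀ y, 0 ≤ y → y < d → y ≤ x + r → f y ≤ A
  left : (x = x' ∧ x + r ≤ 2 * n) ∨ (r ≤ x ∧ SatL n A g d' (richness r) x')
  right : (d - x = d' - x' ∧ d - x + r ≤ 2 * n ∧ A = K) ∨
    (x + r < d ∧ SatR n K g d' (richness r) x')

section OneBlock

variable {n K : ℕ} {f g : ℤ → ℕ} {d d' : ℤ} {A r : ℕ} {x x' : ℤ}

theorem Saturated.ctxRel (hE : Arena n K f g d d') (h : Saturated n K f g d d' A r x x') :
    CtxRel f g 0 d d' x x' := by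
  have h1 := hE.len
  have h2 := hE.len'
  have hs : 1 ≤ richness r := richness_le (Nat.zero_le r)
  refine ⟨by simpa using h.loc 0 (by simp), ?_⟩
  rcases h.left with hl | ⟨hl, y, hy, hyx⟩ <;> rcases h.right with hr | ⟨hr, z, hz, hzx⟩
  · omega
  · omega
  · have := hy.le_of_le h.one_le (Nat.zero_le _) le_rfl
    have := hy.nonneg
    omega
  · have := hy.le_of_le h.one_le (Nat.zero_le _) le_rfl
    have := hy.nonneg
    have := hz.add_le hE.one_le hs le_rfl
    have := hz.le
    omega

/-- A step to a neighbour is forced; the matching radius shrinks by one and absorbs it. -/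
theorem Saturated.adjacent (h : Saturated n K f g d d' A (r + 1) x x') (hK : 1 ≤ K) {j : ℤ}
    (h1 : -1 ≤ j - x) (h2 : j - x ≤ 1) : Saturated n K f g d d' A r j (x' + (j - x)) where
  loc t ht := by
    have := h.loc (j - x + t) (by rw [abs_le] at *; push_cast; omega)
    rwa [show x + (j - x + t) = j + t by ring, ← add_assoc] at this
  one_le := h.one_le
  le := h.le
  low y hy0 hyd hyj := h.low y hy0 hyd (by push_cast; omega)
  left := by
    have hs : richness r < richness (r + 1) := by simp only [richness]; omega
    rcases h.left with hl | ⟨hl, hs'⟩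
    · left; push_cast at hl; omega
    · right; push_cast at hl
      exact ⟨by omega, hs'.of_lt h.one_le hs (by omega)⟩
  right := by
    have hs : richness r < richness (r + 1) := by simp only [richness]; omega
    rcases h.right with hl | ⟨hl, hs'⟩
    · left; push_cast at hl; omega
    · right; push_cast at hl
      exact ⟨by omega, hs'.of_lt hK hs (by omega)⟩

/-- Near an end Duplicator copies the distance to it. Elsewhere she goes to a full interval over the
whole alphabet, which leaves such intervals on both sides of her pebble; hence the bound on the left
may rise from `A` to `K`. -/
theorem Saturated.exists_right (hE : Arena n K f g d d') (hr : r + 1 ≤ n)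
    (h : Saturated n K f g d d' A (r + 1) x x') {j : ℤ} (hj : x + 2 ≤ j) :
    ∃ j', x' + 2 ≤ j' ∧ Saturated n K f g d d' K r j j' := by
  have hd := hE.len
  have hd' := hE.len'
  have hK := hE.one_le
  have hs : richness (r + 1) = 2 * richness r + 3 := rfl
  have hleft := h.left
  have hright := h.right
  push_cast at hleft hright
  have hlow : ∀ y, 0 ≤ y → y < d → y ≤ j + r → f y ≤ K := fun y h0 hyd _ => hE.le y h0 hyd
  by_cases hc : (d - x = d' - x' ∧ d - x + (r + 1) ≤ 2 * n ∧ A = K) ∨ d ≤ j + r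
  · refine ⟨j + (d' - d), ?_, ?_, hK, le_rfl, hlow, ?_, ?_⟩
    · rcases hright with hx | ⟨-, y, hy, hyx⟩
      · omega
      · have := hy.add_le hK (a := 0) (b := richness (r + 1)) (by omega) le_rfl
        have := hy.le
        omega
    · intro t ht
      rw [abs_le] at ht
      have := hE.right (j - d + t) (by omega)
      rwa [show d + (j - d + t) = j + t by ring,
        show d' + (j - d + t) = j + (d' - d) + t by ring] at this
    · right
      refine ⟨by omega, ?_⟩
      rcases hright with hx | ⟨-, y, hy, hyx⟩
      · rcases hleft with hl | ⟨-, hl⟩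
        · omega
        · obtain ⟨h1, h2, rfl⟩ := hx
          exact hl.of_lt hK (by omega) (by omega)
      · have := hy.add_le hK (a := 0 + richness r) (b := richness (r + 1)) (by omega) le_rfl
        have := hy.le
        exact ⟨_, hy.sub hK (a := 0) (s' := richness r) (by omega), by omega⟩
    · left; omega
  · push Not at hc
    have hx : x + (r + 1) < d ∧ SatR n K g d' (richness (r + 1)) x' := by
      rcases hright with hx | hx
      · exact absurd hx.2.2 (fun h => hc.1 hx.1 hx.2.1 h)
      · exact hx
    obtain ⟨y, hy, hyx⟩ := hx.2
    by_cases hjr : (r : ℤ) ≤ j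
    -- Of the `2 * richness r + 3` intervals the middle one is used. On either side `richness r` are
    -- kept and one is spare; the spare ones keep the answer away from the old pebble.
    · obtain ⟨z, hz1, hz2, hz⟩ := (hy.full (richness r + 1) (by omega)).exists_match hK
        (f := f) (j := j) (r := r) (by omega) (by
          rcases hE.sparse j r (by omega) hjr hc.2 with h0 | ⟨e, he, h1, h0⟩
          · exact Or.inl h0
          · refine Or.inr ⟨e, he, h1, hE.le _ ?_ ?_, h0⟩ <;> rw [abs_le] at he <;> omega)
      have h0 := hy.add_le hK (a := 0) (b := richness r + 1) (by omega) (by omega)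
      have h1 := hy.add_le hK (a := richness r) (b := richness r + 1) (by omega) (by omega)
      refine ⟨z, by omega, hz, hK, le_rfl, hlow, Or.inr ⟨hjr, ?_⟩, Or.inr ⟨hc.2, ?_⟩⟩
      · exact ⟨_, hy.sub hK (a := 0) (s' := richness r) (by omega), by simp only [zero_add]; omega⟩
      · exact ⟨_, hy.sub hK (a := richness r + 1 + 1) (s' := richness r) (by omega), by
          simp only [add_zero]; omega⟩
    · refine ⟨j, by omega, ?_, hK, le_rfl, hlow, Or.inl ⟨rfl, by omega⟩, Or.inr ⟨by omega, ?_⟩⟩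
      · intro t ht
        rw [abs_le] at ht
        exact hE.left _ (by omega)
      · have h0 := hy.add_le hK (a := 0) (b := 1) (by omega) (by omega)
        have := hy.nonneg
        exact ⟨_, hy.sub hK (a := 1) (s' := richness r) (by omega), by simp only [add_zero]; omega⟩

/-- To the left of the pebble Spoiler meets only letters up to `A`, so intervals full for `A`
suffice and the bound `A` persists. Reaching the right end this way is possible only if the pebble
was already there, and then `A = K`. -/
theorem Saturated.exists_left (hE : Arena n K f g d d') (hr : r + 1 ≤ n)
    (h : Saturated n K f g d d' A (r + 1) x x') {j : ℤ} (hj : j + 2 ≤ x) :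
    ∃ j', j' + 2 ≤ x' ∧ Saturated n K f g d d' A r j j' := by
  have hd := hE.len
  have hd' := hE.len'
  have hK := hE.one_le
  have hA := h.one_le
  have hs : richness (r + 1) = 2 * richness r + 3 := rfl
  have hleft := h.left
  have hright := h.right
  push_cast at hleft hright
  have hlow : ∀ y, 0 ≤ y → y < d → y ≤ j + r → f y ≤ A := fun y h0 hyd hyj =>
    h.low y h0 hyd (by push_cast; omega)
  by_cases hc : (x = x' ∧ x + (r + 1) ≤ 2 * n) ∨ j < r
  · have hjx : j + 2 ≤ x' := by
      rcases hleft with hx | ⟨-, y, hy, hyx⟩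
      · omega
      · have := hy.add_le hA (a := 0) (b := richness (r + 1)) (by omega) le_rfl
        have := hy.nonneg
        omega
    refine ⟨j, hjx, ?_, hA, h.le, hlow, Or.inl ⟨rfl, by omega⟩, Or.inr ⟨by omega, ?_⟩⟩
    · intro t ht
      rw [abs_le] at ht
      exact hE.left _ (by omega)
    · rcases hright with ⟨h1, h2, rfl⟩ | ⟨-, hx⟩
      · rcases hleft with hl | ⟨-, y, hy, hyx⟩
        · omega
        · have h0 := hy.add_le hK (a := 0) (b := 1) (by omega) (by omega)
          have := hy.nonneg
          exact ⟨_, hy.sub hK (a := 1) (s' := richness r) (by omega), by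
            simp only [add_zero]; omega⟩
      · exact hx.of_lt hK (by omega) (by omega)
  · have hx : (r + 1 : ℤ) ≤ x ∧ SatL n A g d' (richness (r + 1)) x' := by
      rcases hleft with hx | hx
      · exact absurd (Or.inl hx) hc
      · exact hx
    obtain ⟨y, hy, hyx⟩ := hx.2
    have hjr : (r : ℤ) ≤ j := by omega
    by_cases hjd : j + r < d
    · obtain ⟨z, hz1, hz2, hz⟩ := (hy.full (richness r + 1) (by omega)).exists_match hA
        (f := f) (j := j) (r := r) (by omega) (by
          rcases hE.sparse j r (by omega) hjr hjd with h0 | ⟨e, he, h1, h0⟩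
          · exact Or.inl h0
          · refine Or.inr ⟨e, he, h1, hlow _ ?_ ?_ ?_, h0⟩ <;> rw [abs_le] at he <;> omega)
      have h1 := hy.add_le hA (a := richness r) (b := richness r + 1) (by omega) (by omega)
      have h2 := hy.add_le hA (a := richness r + 1 + 1) (b := richness (r + 1)) (by omega) le_rfl
      refine ⟨z, by omega, hz, hA, h.le, hlow, Or.inr ⟨hjr, ?_⟩, Or.inr ⟨hjd, ?_⟩⟩
      · exact ⟨_, hy.sub hA (a := 0) (s' := richness r) (by omega), by simp only [zero_add]; omega⟩
      · rcases hright with ⟨-, -, rfl⟩ | ⟨-, hx⟩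
        · exact ⟨_, hy.sub hK (a := richness r + 1 + 1) (s' := richness r) (by omega), by
            simp only [add_zero]; omega⟩
        · exact hx.of_lt hK (by omega) (by omega)
    · obtain ⟨h1, h2, rfl⟩ : d - x = d' - x' ∧ d - x + (r + 1) ≤ 2 * n ∧ A = K := by
        rcases hright with hx | hx
        · exact hx
        · omega
      refine ⟨j + (d' - d), by omega, ?_, hA, le_rfl, hlow, Or.inr ⟨hjr, ?_⟩,
        Or.inl ⟨by omega, by omega, rfl⟩⟩
      · intro t ht
        rw [abs_le] at ht
        have := hE.right (j - d + t) (by omega)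
        rwa [show d + (j - d + t) = j + t by ring,
          show d' + (j - d + t) = j + (d' - d) + t by ring] at this
      · have := hy.add_le hK (a := 0 + richness r) (b := richness (r + 1)) (by omega) le_rfl
        have := hy.le
        exact ⟨_, hy.sub hK (a := 0) (s' := richness r) (by omega), by omega⟩

theorem Saturated.sim (hE : Arena n K f g d d') : ∀ {r A : ℕ} {x x' : ℤ}, r ≤ n →
    Saturated n K f g d d' A r x x' → Sim 1 r (CtxRel f g 0 d d') x x' := by
  intro r
  induction r with
  | zero => intro A x x' _ h; simpa [Sim] using h.ctxRel hE
  | succ r ih =>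
    intro A x x' hr h
    rw [Sim]
    refine ⟨h.ctxRel hE, fun j => ?_, by simpa [Sim, flip] using h.ctxRel hE⟩
    rcases lt_or_ge (j + 1) x with hj | hj
    · obtain ⟨j', hj', hs⟩ := h.exists_left hE hr (j := j) (by omega)
      exact ⟨j', Or.inl ⟨by omega, hj'⟩, ih (by omega) hs⟩
    rcases lt_or_ge (x + 1) j with hj2 | hj2
    · obtain ⟨j', hj', hs⟩ := h.exists_right hE hr (j := j) (by omega)
      exact ⟨j', Or.inr (Or.inr ⟨by omega, hj'⟩), ih (by omega) hs⟩
    · exact ⟨_, Or.inr (Or.inl ⟨by omega, by omega, by ring⟩),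
        ih (by omega) (h.adjacent hE.one_le (by omega) (by omega))⟩

end OneBlock

/-! ### Padded segments -/

/-- The word `f` shows, from position `a` on, the letters of the list `c`, each of them in the
middle of a block of `6 * n + 7` positions which are otherwise padding. -/
def Seg (n : ℕ) (f : ℤ → ℕ) : ℤ → List ℕ → Prop
  | _, [] => True
  | a, e :: c => (f (a + (3 * n + 3)) = e ∧
      ∀ t : ℤ, t ≠ 0 → |t| ≤ 3 * n + 3 → f (a + (3 * n + 3) + t) = 0) ∧
      Seg n f (a + (6 * n + 7)) c

/-- The number of positions taken by a padded list. -/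
def segLen (n : ℕ) (c : List ℕ) : ℤ := (6 * n + 7) * c.length

section Seg

variable {n : ℕ} {f : ℤ → ℕ} {a : ℤ} {c c' : List ℕ}

@[simp] theorem segLen_nil : segLen n [] = 0 := by simp [segLen]

@[simp] theorem segLen_cons (e : ℕ) : segLen n (e :: c) = (6 * n + 7) + segLen n c := by
  simp [segLen]; ring

@[simp] theorem segLen_append : segLen n (c ++ c') = segLen n c + segLen n c' := by
  simp [segLen]; ring

@[simp] theorem segLen_reverse : segLen n c.reverse = segLen n c := by simp [segLen]

theorem segLen_nonneg (n : ℕ) (c : List ℕ) : 0 ≤ segLen n c := by unfold segLen; positivity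

theorem le_segLen (n : ℕ) (hc : c ≠ []) : 6 * n + 7 ≤ segLen n c := by
  obtain ⟨e, c, rfl⟩ := List.exists_cons_of_ne_nil hc
  have := segLen_nonneg n c
  rw [segLen_cons]; omega

theorem seg_append : ∀ {a : ℤ}, Seg n f a (c ++ c') ↔ Seg n f a c ∧ Seg n f (a + segLen n c) c' := by
  induction c with
  | nil => intro a; simp [Seg]
  | cons e c ih => intro a; simp only [List.cons_append, Seg, ih, segLen_cons, and_assoc, add_assoc]

theorem Seg.eq {g : ℤ → ℕ} : ∀ {a b : ℤ}, Seg n f a c → Seg n g b c →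
    ∀ {x : ℤ}, 0 ≤ x → x < segLen n c → f (a + x) = g (b + x) := by
  induction c with
  | nil => intro a b _ _ x h0 hx; rw [segLen_nil] at hx; omega
  | cons e c ih =>
    intro a b hf hg x h0 hx
    rw [segLen_cons] at hx
    by_cases h1 : x < 6 * n + 7
    · by_cases h2 : x = 3 * n + 3
      · rw [h2, hf.1.1, hg.1.1]
      · have hf' := hf.1.2 (x - (3 * n + 3)) (by omega) (by rw [abs_le]; omega)
        have hg' := hg.1.2 (x - (3 * n + 3)) (by omega) (by rw [abs_le]; omega)
        rw [show a + x = a + (3 * n + 3) + (x - (3 * n + 3)) by ring, hf',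
          show b + x = b + (3 * n + 3) + (x - (3 * n + 3)) by ring, hg']
    · have := ih hf.2 hg.2 (x := x - (6 * n + 7)) (by omega) (by omega)
      rwa [show a + (6 * n + 7) + (x - (6 * n + 7)) = a + x by ring,
        show b + (6 * n + 7) + (x - (6 * n + 7)) = b + x by ring] at this

/-- The `+ 1` comes from half-open intervals: `x ↦ C - x` sends `[a, a + l)` to `[C - (a + l) + 1, C
- a + 1)`. -/
theorem Seg.reverse : ∀ {a : ℤ}, Seg n f a c → ∀ C : ℤ,
    Seg n (fun x => f (C - x)) (C - (a + segLen n c) + 1) c.reverse := by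
  induction c with
  | nil => intros; trivial
  | cons e c ih =>
    intro a h C
    rw [List.reverse_cons, seg_append, segLen_reverse]
    refine ⟨?_, ⟨⟨?_, fun t h0 ht => ?_⟩, trivial⟩⟩
    · have := ih h.2 C
      rwa [add_assoc, ← segLen_cons e] at this
    · rw [← h.1.1]
      refine congrArg f ?_; rw [segLen_cons]; ring
    · rw [← h.1.2 (-t) (by omega) (by rwa [abs_neg])]
      refine congrArg f ?_; rw [segLen_cons]; ring

/-- A letter in a padded list is an entry of the list, isolated by padding. -/
theorem Seg.of_ne_zero : ∀ {a : ℤ}, Seg n f a c → ∀ {y : ℤ}, a ≤ y → y < a + segLen n c → f y ≠ 0 →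
    f y ∈ c ∧ a + (3 * n + 3) ≤ y ∧ y + (3 * n + 3) < a + segLen n c ∧
      ∀ t : ℤ, t ≠ 0 → |t| ≤ 3 * n + 3 → f (y + t) = 0 := by
  induction c with
  | nil => intro a _ y h1 h2; simp at h2; omega
  | cons e c ih =>
    intro a h y h1 h2 h0
    have hc := segLen_nonneg n c
    rw [segLen_cons] at *
    by_cases hy : y < a + (6 * n + 7)
    · by_cases hya : y = a + (3 * n + 3)
      · subst hya
        exact ⟨by simp [h.1.1], le_rfl, by omega, h.1.2⟩
      · have := h.1.2 (y - (a + (3 * n + 3))) (by omega) (by rw [abs_le]; omega)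
        rw [add_sub_cancel] at this
        exact absurd this h0
    · obtain ⟨i1, i2, i3, i4⟩ := ih h.2 (y := y) (by omega) (by omega) h0
      exact ⟨List.mem_cons_of_mem _ i1, by omega, by omega, i4⟩

theorem Seg.exists_of_mem : ∀ {a : ℤ}, Seg n f a c → ∀ {e : ℕ}, e ∈ c →
    ∃ z, a + (3 * n + 3) ≤ z ∧ z + (3 * n + 3) < a + segLen n c ∧ f z = e ∧
      ∀ t : ℤ, t ≠ 0 → |t| ≤ 3 * n + 3 → f (z + t) = 0 := by
  induction c with
  | nil => intro a _ e h; simp at h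
  | cons e' c ih =>
    intro a h e he
    have hc := segLen_nonneg n c
    rw [segLen_cons]
    rcases List.mem_cons.1 he with rfl | he
    · exact ⟨_, le_rfl, by omega, h.1⟩
    · obtain ⟨z, h1, h2, h3⟩ := ih h.2 he
      exact ⟨z, by omega, by omega, h3⟩

theorem Seg.full {A : ℕ} (h : Seg n f a c) (hA : ∀ e, 1 ≤ e → e ≤ A → e ∈ c) :
    Full n A f a (a + segLen n c) :=
  fun e h1 h2 => h.exists_of_mem (hA e h1 h2)

theorem Seg.le {K : ℕ} (h : Seg n f a c) (hK : ∀ e ∈ c, e ≤ K) {y : ℤ} (h1 : a ≤ y)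
    (h2 : y < a + segLen n c) : f y ≤ K := by
  by_cases h0 : f y = 0
  · omega
  · exact hK _ (h.of_ne_zero h1 h2 h0).1

theorem Seg.eq_zero (h : Seg n f a c) {y : ℤ} (h1 : a ≤ y) (h2 : y < a + segLen n c)
    (hy : y < a + (3 * n + 3) ∨ a + segLen n c ≤ y + (3 * n + 3)) : f y = 0 := by
  by_contra h0
  obtain ⟨-, h3, h4, -⟩ := h.of_ne_zero h1 h2 h0
  omega

/-- `s` copies of the list `c`. -/
def copies (s : ℕ) (c : List ℕ) : List ℕ := (List.replicate s c).flatten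

theorem copies_add (s t : ℕ) (c : List ℕ) : copies (s + t) c = copies s c ++ copies t c := by
  rw [copies, List.replicate_add, List.flatten_append]; rfl

theorem copies_succ (s : ℕ) (c : List ℕ) : copies (s + 1) c = c ++ copies s c := by
  simp [copies, List.replicate_succ]

theorem copies_reverse (s : ℕ) (c : List ℕ) : (copies s c).reverse = copies s c.reverse := by
  simp [copies, List.reverse_flatten]

theorem segLen_copies (s : ℕ) : segLen n (copies s c) = s * segLen n c := by
  induction s with
  | zero => simp [copies]
  | succ s ih => rw [copies_succ, segLen_append, ih]; push_cast; ring

theorem Seg.chain {A s : ℕ} {d : ℤ} (h : Seg n f a (copies s c))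
    (hA : ∀ e, 1 ≤ e → e ≤ A → e ∈ c) (ha : 0 ≤ a) (hd : a + segLen n (copies s c) ≤ d) :
    Chain n A f d s (fun t => a + t * segLen n c) where
  nonneg := by simpa using ha
  le := by rwa [segLen_copies] at hd
  full t ht := by
    obtain ⟨u, rfl⟩ : ∃ u, s = t + (u + 1) := ⟨s - t - 1, by omega⟩
    rw [copies_add, copies_succ, seg_append, seg_append, segLen_copies] at h
    have := h.2.1.full hA
    rwa [show a + (t : ℤ) * segLen n c + segLen n c = a + ((t + 1 : ℕ) : ℤ) * segLen n c by
      push_cast; ring] at this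

end Seg

/-! ### The nested words and the induction on blocks -/

/-- The letters `K, 1, …, K - 1`. -/
def alphabetWord (K : ℕ) : List ℕ := K :: List.range' 1 (K - 1)

theorem mem_alphabetWord {K e : ℕ} (hK : 1 ≤ K) : e ∈ alphabetWord K ↔ 1 ≤ e ∧ e ≤ K := by
  simp only [alphabetWord, List.mem_cons, List.mem_range'_1]; omega

/-- The words of the hierarchy, before padding: `nest T b k N` has the letters `1, …, k + 1`, and
only its innermost part depends on `b`. -/
def nest (T : ℕ) (b : Bool) : ℕ → ℕ → List ℕ
  | 0, _ => if b then [1] else []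
  | k + 1, N => (nest T b k (2 * T)).reverse ++ copies N (alphabetWord (k + 2))

section nest

variable {T : ℕ} {b : Bool} {k N : ℕ}

theorem nest_add (M : ℕ) : nest T b (k + 1) (N + M) =
    nest T b (k + 1) N ++ copies M (alphabetWord (k + 2)) := by
  simp [nest, copies_add]

theorem mem_copies {s e : ℕ} {c : List ℕ} (h : e ∈ copies s c) : e ∈ c := by
  simp only [copies, List.mem_flatten, List.mem_replicate] at h
  obtain ⟨l, ⟨-, rfl⟩, h⟩ := h
  exact h

theorem mem_nest : ∀ {k N e : ℕ}, e ∈ nest T b k N → 1 ≤ e ∧ e ≤ k + 1 := by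
  intro k
  induction k with
  | zero => intro N e h; cases b <;> simp [nest] at h; omega
  | succ k ih =>
    intro N e h
    rw [nest, List.mem_append, List.mem_reverse] at h
    rcases h with h | h
    · have := ih h; omega
    · have := (mem_alphabetWord (by omega)).1 (mem_copies h); omega

end nest

/-- Both segments begin and end with `3 * n + 3` positions of padding, which extends the agreement
outside by the required `2 * n` inwards. -/
theorem Arena.of_seg {n K : ℕ} {f g : ℤ → ℕ} {c c' : List ℕ} (hK : 1 ≤ K) (hc : c ≠ [])
    (hc' : c' ≠ []) (hf : Seg n f 0 c) (hg : Seg n g 0 c') (hle : ∀ e ∈ c, e ≤ K)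
    (hl : ∀ y < 0, f y = g y) (hr : ∀ t, 0 ≤ t → f (segLen n c + t) = g (segLen n c' + t)) :
    Arena n K f g (segLen n c) (segLen n c') where
  one_le := hK
  len := by have := le_segLen n hc; omega
  len' := by have := le_segLen n hc'; omega
  left y hy := by
    have h1 := le_segLen n hc
    have h2 := le_segLen n hc'
    rcases lt_or_ge y 0 with h0 | h0
    · exact hl y h0
    · rw [hf.eq_zero h0 (by omega) (by omega), hg.eq_zero h0 (by omega) (by omega)]
  right t ht := by
    have h1 := le_segLen n hc
    have h2 := le_segLen n hc'
    rcases lt_or_ge t 0 with h0 | h0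
    · rw [hf.eq_zero (by omega) (by omega) (by omega), hg.eq_zero (by omega) (by omega) (by omega)]
    · exact hr t h0
  le y h0 hy := hf.le hle h0 (by omega)
  sparse j r hr' hj hjd := by
    by_cases h : ∀ t : ℤ, |t| ≤ r → f (j + t) = 0
    · exact Or.inl h
    · push Not at h
      obtain ⟨e, he, hne⟩ := h
      refine Or.inr ⟨e, he, by omega, fun t ht hte => ?_⟩
      rw [abs_le] at ht he
      have := (hf.of_ne_zero (y := j + e) (by omega) (by omega) hne).2.2.2 (t - e) (by omega)
        (by rw [abs_le]; omega)
      rwa [show j + e + (t - e) = j + t by ring] at this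

/-- The pairs of corresponding positions outside of the segments `[c, d)` and `[c, d')`. -/
def Outside (c d d' x x' : ℤ) : Prop := (x < c ∧ x' = x) ∨ (d ≤ x ∧ x' - d' = x - d)

theorem Arena.sim_outside {n K : ℕ} {f g : ℤ → ℕ} {d d' : ℤ} (hE : Arena n K f g d d') {y : ℕ → ℤ}
    (hy : Chain n K g d' (richness n) y) {r : ℕ} (hr : r ≤ n) {x x' : ℤ}
    (hx : Outside 0 d d' x x') : Sim 1 r (CtxRel f g 0 d d') x x' := by
  have hd := hE.len
  have hrich := richness_le hr
  have hsub := hy.sub hE.one_le (a := 0) (s' := richness r) (by omega)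
  have h0 := hy.nonneg
  have h1 := hsub.le
  refine Saturated.sim hE hr (A := K) ⟨?_, hE.one_le, le_rfl, fun y h0 h1 _ => hE.le y h0 h1, ?_, ?_⟩
  · intro t ht
    rw [abs_le] at ht
    rcases hx with hx | hx
    · rw [hx.2]; exact hE.left _ (by omega)
    · have := hE.right (x - d + t) (by omega)
      rwa [show d + (x - d + t) = x + t by ring,
        show d' + (x - d + t) = x' + t by omega] at this
  · rcases hx with hx | hx
    · left; omega
    · exact Or.inr ⟨by omega, _, hsub, by omega⟩
  · rcases hx with hx | hx
    · exact Or.inr ⟨by omega, _, hsub, by simp only [add_zero]; omega⟩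
    · left; omega

/-- One block of moves starting in the middle of two words that agree outside of the middle, which
is surrounded by many copies of the alphabet. -/
theorem Arena.sim_inside {n K A : ℕ} {f g : ℤ → ℕ} {d d' : ℤ} (hE : Arena n K f g d d') (hA : 1 ≤ A)
    (hAK : A ≤ K) {c e c' e' : ℤ} {y z : ℕ → ℤ} (hy : Chain n A g d' (richness n) y)
    (hyc : y (richness n) ≤ c') (hz : Chain n K g d' (richness n) z) (hze : e' ≤ z 0)
    (hc : n ≤ c) (he : e + n ≤ d) (hlow : ∀ y, 0 ≤ y → y < e + n → f y ≤ A) {r : ℕ} (hr : r ≤ n)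
    {x x' : ℤ} (hx : c ≤ x ∧ x < e) (hx' : c' ≤ x' ∧ x' < e')
    (hloc : ∀ t : ℤ, |t| ≤ r → f (x + t) = g (x' + t)) : Sim 1 r (CtxRel f g 0 d d') x x' := by
  have hrich := richness_le hr
  have hy1 := hy.le_of_le hA hrich le_rfl
  refine Saturated.sim hE hr (A := A) ⟨hloc, hA, hAK, fun y h0 h1 hyx => hlow y h0 (by omega),
    Or.inr ⟨by omega, _, hy.sub hA (a := 0) (s' := richness r) (by omega), ?_⟩,
    Or.inr ⟨by omega, _, hz.sub hE.one_le (a := 0) (s' := richness r) (by omega), ?_⟩⟩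
  · simp only [zero_add]; omega
  · simp only [add_zero]; omega

theorem sim_nest (n : ℕ) : ∀ (k N : ℕ) (b b' : Bool) (f g : ℤ → ℕ) (d d' : ℤ), richness n ≤ N →
    Seg n f 0 (nest (richness n) b (k + 1) N) → Seg n g 0 (nest (richness n) b' (k + 1) N) →
    d = segLen n (nest (richness n) b (k + 1) N) →
    d' = segLen n (nest (richness n) b' (k + 1) N) →
    (∀ y < 0, f y = g y) → (∀ t, 0 ≤ t → f (d + t) = g (d' + t)) →
    ∀ r ≤ n, ∀ x x', Outside 0 d d' x x' → Sim (k + 1) r (CtxRel f g 0 d d') x x' := by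
  have hrich : 1 ≤ richness n := richness_le (Nat.zero_le n)
  set T := richness n with hT
  have hne : ∀ b k N, T ≤ N → nest T b (k + 1) N ≠ [] := by
    intro b k N hN h
    obtain ⟨N, rfl⟩ : ∃ N', N = N' + 1 := ⟨N - 1, by omega⟩
    simp [nest, copies_succ, alphabetWord] at h
  have harena : ∀ (k N : ℕ) (b b' : Bool) (f g : ℤ → ℕ), T ≤ N →
      Seg n f 0 (nest T b (k + 1) N) → Seg n g 0 (nest T b' (k + 1) N) → (∀ y < 0, f y = g y) →
      (∀ t, 0 ≤ t → f (segLen n (nest T b (k + 1) N) + t) =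
        g (segLen n (nest T b' (k + 1) N) + t)) →
      Arena n (k + 2) f g (segLen n (nest T b (k + 1) N)) (segLen n (nest T b' (k + 1) N)) :=
    fun k N b b' f g hN hf hg hl hr => Arena.of_seg (by omega) (hne _ _ _ hN) (hne _ _ _ hN) hf hg
      (fun e he => (mem_nest he).2) hl hr
  have hchain : ∀ (k N : ℕ) (b : Bool) (g : ℤ → ℕ), T ≤ N → Seg n g 0 (nest T b (k + 1) N) →
      ∃ y, Chain n (k + 2) g (segLen n (nest T b (k + 1) N)) T y ∧
        y 0 = segLen n (nest T b k (2 * T)) := by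
    intro k N b g hN hg
    obtain ⟨u, rfl⟩ : ∃ u, N = T + u := ⟨N - T, by omega⟩
    rw [nest_add, seg_append, nest, seg_append] at hg
    refine ⟨_, hg.1.2.chain (A := k + 2) (fun e h1 h2 => (mem_alphabetWord (by omega)).2 ⟨h1, h2⟩)
      ?_ ?_, ?_⟩
    · rw [zero_add]; exact segLen_nonneg _ _
    · have := segLen_nonneg n (copies u (alphabetWord (k + 2)))
      rw [nest_add, nest]; simp only [segLen_append, segLen_reverse]; omega
    · simp
  intro k
  induction k with
  | zero =>
    rintro N b b' f g _ _ hN hf hg rfl rfl hl hr r hrn x x' hx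
    obtain ⟨y, hy, -⟩ := hchain 0 N b' g hN hg
    exact (harena 0 N b b' f g hN hf hg hl hr).sim_outside hy hrn hx
  | succ k ih =>
    -- Half of the `2 * T` copies become the left surroundings of the middle part; the other `T`
    -- stay in it for the induction hypothesis.
    have hsplit : ∀ b, (nest T b (k + 1) (2 * T)).reverse =
        copies T (alphabetWord (k + 2)).reverse ++ (nest T b (k + 1) T).reverse := by
      intro b
      rw [two_mul, nest_add, List.reverse_append, copies_reverse]
    set C := segLen n (copies T (alphabetWord (k + 2)).reverse) with hC
    have hlen : ∀ b N, segLen n (nest T b (k + 1 + 1) N) =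
        C + segLen n (nest T b (k + 1) T) + segLen n (copies N (alphabetWord (k + 3))) := by
      intro b N
      rw [nest, hsplit]; simp [hC, add_assoc]
    have hlen2 : ∀ b, segLen n (nest T b (k + 1) (2 * T)) = C + segLen n (nest T b (k + 1) T) := by
      intro b
      rw [← segLen_reverse, hsplit]; simp [hC]
    have hCn : (n : ℤ) ≤ C := by
      have : copies T (alphabetWord (k + 2)).reverse ≠ [] := by
        obtain ⟨u, hu⟩ : ∃ u, T = u + 1 := ⟨T - 1, by omega⟩
        simp [hu, copies_succ, alphabetWord]
      have := le_segLen n this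
      omega
    have hlast : ∀ N, T ≤ N → (6 * n + 7 : ℤ) ≤ segLen n (copies N (alphabetWord (k + 3))) := by
      intro N hN
      apply le_segLen
      obtain ⟨u, hu⟩ : ∃ u, N = u + 1 := ⟨N - 1, by omega⟩
      simp [hu, copies_succ, alphabetWord]
    have hparts : ∀ (N : ℕ) (b : Bool) (f : ℤ → ℕ), Seg n f 0 (nest T b (k + 1 + 1) N) →
        Seg n f 0 (copies T (alphabetWord (k + 2)).reverse) ∧
          Seg n f C (nest T b (k + 1) T).reverse ∧
            Seg n f (C + segLen n (nest T b (k + 1) T)) (copies N (alphabetWord (k + 3))) := by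
      intro N b f hf
      rw [nest, hsplit, List.append_assoc, seg_append, seg_append, segLen_reverse, zero_add] at hf
      exact hf
    -- the game on the middle parts, read from right to left
    have hmid : ∀ (N : ℕ) (b b' : Bool) (f g : ℤ → ℕ) (d d' : ℤ),
        Seg n f 0 (nest T b (k + 1 + 1) N) → Seg n g 0 (nest T b' (k + 1 + 1) N) →
        d = C + segLen n (nest T b (k + 1) T) → d' = C + segLen n (nest T b' (k + 1) T) →
        (∀ y < 0, f y = g y) → (∀ t, 0 ≤ t →
          f (segLen n (nest T b (k + 1 + 1) N) + t) = g (segLen n (nest T b' (k + 1 + 1) N) + t)) →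
        ∀ r ≤ n, ∀ x x', Outside C d d' x x' → Sim (k + 1) r (CtxRel f g C d d') x x' := by
      intro N b b' f g d d' hf hg hd hd' hl hr r hrn x x' hx
      obtain ⟨hf1, hf2, hf3⟩ := hparts N b f hf
      obtain ⟨hg1, hg2, hg3⟩ := hparts N b' g hg
      rw [← hd] at hf3
      rw [← hd'] at hg3
      rw [hlen, hlen, ← hd, ← hd'] at hr
      have hlen3 := segLen_nonneg n (copies N (alphabetWord (k + 3)))
      -- Reflection in `d - 1` and `d' - 1` turns the middle parts into unreversed segments starting
      -- at `0`, as the induction hypothesis requires.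
      have hf4 := hf2.reverse (d - 1)
      have hg4 := hg2.reverse (d' - 1)
      rw [List.reverse_reverse, segLen_reverse, show d - 1 - (C + _) + 1 = 0 by rw [hd]; ring] at hf4
      rw [List.reverse_reverse, segLen_reverse,
        show d' - 1 - (C + _) + 1 = 0 by rw [hd']; ring] at hg4
      have hright : ∀ t, 0 ≤ t → f (d + t) = g (d' + t) := by
        intro t ht
        by_cases htl : t < segLen n (copies N (alphabetWord (k + 3)))
        · exact hf3.eq hg3 ht htl
        · have := hr (t - segLen n (copies N (alphabetWord (k + 3)))) (by omega)
          rwa [add_assoc, add_sub_cancel, add_assoc, add_sub_cancel] at this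
      have hleft : ∀ y < C, f y = g y := by
        intro y hy
        rcases lt_or_ge y 0 with h0 | h0
        · exact hl y h0
        · simpa using hf1.eq hg1 h0 hy
      have hsim := ih T b b' _ _ _ _ le_rfl hf4 hg4 rfl rfl
        (fun y hy => by
          have := hright (-1 - y) (by omega)
          rwa [show d + (-1 - y) = d - 1 - y by ring, show d' + (-1 - y) = d' - 1 - y by ring] at this)
        (fun t ht => by
          have := hleft (C - 1 - t) (by omega)
          rwa [show d - 1 - (segLen n (nest T b (k + 1) T) + t) = C - 1 - t by omega,
            show d' - 1 - (segLen n (nest T b' (k + 1) T) + t) = C - 1 - t by omega])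
        r hrn (d - 1 - x) (d' - 1 - x') (by unfold Outside at *; omega)
      have := Sim.reflect (R := CtxRel f g C d d') (a := d - 1) (b := d' - 1)
        (hsim.weaken fun x y h => by
          unfold CtxRel at *
          exact ⟨h.1, by omega⟩)
      rwa [sub_sub_cancel, sub_sub_cancel] at this
    have hone : ∀ (N : ℕ) (b b' : Bool) (f g : ℤ → ℕ) (d d' : ℤ), T ≤ N →
        Seg n f 0 (nest T b (k + 1 + 1) N) → Seg n g 0 (nest T b' (k + 1 + 1) N) →
        d = C + segLen n (nest T b (k + 1) T) → d' = C + segLen n (nest T b' (k + 1) T) →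
        (∀ y < 0, f y = g y) → (∀ t, 0 ≤ t →
          f (segLen n (nest T b (k + 1 + 1) N) + t) = g (segLen n (nest T b' (k + 1 + 1) N) + t)) →
        ∀ r ≤ n, ∀ x x', Sim 1 r (CtxRel f g C d d') x x' →
          Sim 1 r (CtxRel g f 0 (segLen n (nest T b' (k + 1 + 1) N))
            (segLen n (nest T b (k + 1 + 1) N))) x' x := by
      intro N b b' f g d d' hN hf hg hd hd' hl hr r hrn x x' h
      have h1 := segLen_nonneg n (nest T b (k + 1) T)
      have h2 := segLen_nonneg n (nest T b' (k + 1) T)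
      have h3 := hlast N hN
      have houts : Outside C d d' x x' → Sim 1 r (CtxRel g f 0 (segLen n (nest T b' (k + 1 + 1) N))
            (segLen n (nest T b (k + 1 + 1) N))) x' x := by
        intro ho
        refine (hmid N b' b g f d' d hg hf hd' hd (fun y hy => (hl y hy).symm)
          (fun t ht => (hr t ht).symm) r hrn x' x ?_).one_of_succ.weaken fun x y h => ?_
        · unfold Outside at *; omega
        · unfold CtxRel at *
          rw [hlen, hlen]
          exact ⟨h.1, by omega⟩
      -- Outside of the middle the same game with the words exchanged wins. Inside, the places may
      -- differ and only the neighbourhoods are known to match, so the surrounding copies are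
      -- needed.
      rcases h.rel.2 with ho | ho | ho
      · exact houts (Or.inl ho)
      · exact houts (Or.inr ho)
      · obtain ⟨hf1, hf2, hf3⟩ := hparts N b f hf
        obtain ⟨hg1, hg2, hg3⟩ := hparts N b' g hg
        obtain ⟨z, hz, hz0⟩ := hchain (k + 1) N b f hN hf
        rw [hlen2, ← hd] at hz0
        have hlenb := hlen b N
        have hlenb' := hlen b' N
        refine (harena (k + 1) N b' b g f hN hg hf (fun y hy => (hl y hy).symm)
          (fun t ht => (hr t ht).symm)).sim_inside (A := k + 2) (by omega) (by omega)
          (c := C) (c' := C) (e := d') (e' := d)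
          (hf1.chain (fun e h1 h2 => List.mem_reverse.2 ((mem_alphabetWord (by omega)).2 ⟨h1, h2⟩))
            le_rfl (by omega)) (by rw [zero_add, ← segLen_copies]) hz hz0.ge hCn (by omega) ?_ hrn
          ho.2.2 ⟨ho.1, ho.2.1⟩ (fun t ht => ((h.rel_add t ht).1).symm)
        intro y h0 hy
        rcases lt_or_ge y C with hyC | hyC
        · exact hg1.le (fun e he => ((mem_alphabetWord (by omega)).1
            (List.mem_reverse.1 (mem_copies he))).2) h0 (by omega)
        rcases lt_or_ge y d' with hyd | hyd
        · exact hg2.le (fun e he => (mem_nest (List.mem_reverse.1 he)).2) hyC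
            (by rw [segLen_reverse]; omega)
        -- Up to `n` positions beyond the middle there is only the padding before the first large
        -- letter.
        · rw [hg3.eq_zero (by omega) (by omega) (by omega)]
          omega
    rintro N b b' f g _ _ hN hf hg rfl rfl hl hr r hrn x x' hx
    have h1 := segLen_nonneg n (nest T b (k + 1) T)
    have h2 := segLen_nonneg n (nest T b' (k + 1) T)
    have h3 := hlast N hN
    have hweak : ∀ x y, CtxRel f g C (C + segLen n (nest T b (k + 1) T))
        (C + segLen n (nest T b' (k + 1) T)) x y → CtxRel f g 0 (segLen n (nest T b (k + 1 + 1) N))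
          (segLen n (nest T b' (k + 1 + 1) N)) x y := by
      intro x y h
      unfold CtxRel at *
      rw [hlen, hlen]
      exact ⟨h.1, by omega⟩
    refine Sim.lift (N := n) hrn hweak
      (fun r hr' x y h => (hone N b b' f g _ _ hN hf hg rfl rfl hl hr r hr' x y h).weaken
        fun x y h => h.symm (segLen_nonneg _ _))
      (fun r hr' x y h => hone N b' b g f _ _ hN hg hf rfl rfl (fun y hy => (hl y hy).symm)
        (fun t ht => (hr t ht).symm) r hr' y x
        (h.weaken fun x y h => CtxRel.symm h (by omega)))
      (hmid N b b' f g _ _ hf hg rfl rfl hl hr r hrn x x' ?_)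
    unfold Outside at *
    rw [hlen, hlen] at hx
    omega

/-! ### The separating sentence -/

namespace Formula

variable {A : Type*}

/-- Given formulas `χ 0` and `χ 1` which say that a position lies outside of the segment of
`nest T b k N` (reversed unless `o`), the formulas saying that it lies outside of the innermost
part of this segment. The letter `e` is represented by `q e`. -/
def outer (q : ℕ → A) : ℕ → Bool → (Fin 2 → Formula A) → Fin 2 → Formula A
  | 0, _, χ => χ
  | k + 1, o, χ => outer q k (!o) fun v => or (χ v) (ex (v + 1)
      (and (and (letter (q (k + 2)) (v + 1))
        (or (eq (v + 1) v) (if o then lt (v + 1) v else lt v (v + 1)))) (neg (χ (v + 1)))))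

/-- The sentence which says that the letter `1` occurs in the innermost part. -/
def hierarchySentence (q : ℕ → A) (k : ℕ) : Formula A :=
  ex 0 (and (letter (q 1) 0) (neg (outer q k true (fun _ => falsum) 0)))

/-- Each level adds a single quantifier above the earlier conditions, hence at most one block, in
whatever context it stands. -/
theorem blocksFrom_outer (q : ℕ → A) : ∀ (k t : ℕ) (o : Bool) (χ : Fin 2 → Formula A),
    (∀ pos last v, blocksFrom pos last (χ v) ≤ t) →
    ∀ pos last v, blocksFrom pos last (outer q k o χ v) ≤ t + k := by
  intro k
  induction k with
  | zero => intro t o χ h; exact h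
  | succ k ih =>
    intro t o χ h pos last v
    rw [show t + (k + 1) = t + 1 + k by ring]
    refine ih (t + 1) _ _ (fun pos last v => ?_) pos last v
    have h1 := h pos last v
    have h2 := h (!pos) (some pos) (v + 1)
    cases o <;> simp only [blocksFrom, Bool.false_eq_true, if_false, if_true] <;> split_ifs <;>
      simp <;> omega

theorem freeVars_outer (q : ℕ → A) : ∀ (k : ℕ) (o : Bool) (χ : Fin 2 → Formula A),
    (∀ v, (χ v).freeVars ⊆ {v}) → ∀ v, (outer q k o χ v).freeVars ⊆ {v} := by
  intro k
  induction k with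
  | zero => intro o χ h; exact h
  | succ k ih =>
    intro o χ h v
    refine ih _ _ (fun v => ?_) v
    have h1 := h v
    have h2 := h (v + 1)
    intro u hu
    cases o <;> simp only [freeVars, Finset.mem_union, Finset.mem_erase, Finset.mem_insert,
      Finset.mem_singleton, Bool.false_eq_true, if_false, if_true] at hu ⊢ <;>
    · have h3 : u ∈ (χ v).freeVars → u = v := fun h => by simpa using h1 h
      have h4 : u ∈ (χ (v + 1)).freeVars → u = v + 1 := fun h => by simpa using h2 h
      tauto

theorem isSentence_hierarchySentence (q : ℕ → A) (k : ℕ) : (hierarchySentence q k).IsSentence := by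
  have := freeVars_outer q k true (fun _ => falsum) (fun v => by simp [freeVars]) 0
  simp only [IsSentence, hierarchySentence, freeVars]
  ext u
  have h : u ∈ (outer q k true (fun _ => falsum) 0).freeVars → u = 0 := fun h => by
    simpa using this h
  simp only [Finset.mem_erase, Finset.mem_union, Finset.mem_singleton, Finset.notMem_empty,
    iff_false]
  tauto

theorem blocks_hierarchySentence (q : ℕ → A) (k : ℕ) : (hierarchySentence q k).blocks ≤ k + 1 := by
  have := blocksFrom_outer q k 0 true (fun _ => falsum) (fun _ _ _ => by simp [blocksFrom])
    false (some true) 0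
  simp [blocks, hierarchySentence, blocksFrom]
  omega

end Formula

open Formula

section Semantics

variable {A : Type*} {q : ℕ → A} {m n T : ℕ} {b : Bool} {w : List A} {f : ℤ → ℕ}

/-- The condition describing the innermost part of a segment `[a, e)`, up to padding: the positions
in `[a, e)` before every (resp. after every) position of `[a, e)` that carries the letter `K`. -/
theorem sat_step (hq : ∀ e e', e ≤ m → e' ≤ m → q e = q e' → e = e')
    (hw : ∀ i < w.length, w[i]? = some (q (f i)) ∧ f i ≤ m) {K : ℕ} (hK : K ≠ 0) (hKm : K ≤ m)
    {a e : ℤ} (ha : 0 ≤ a) (he : e ≤ w.length) {χ : Fin 2 → Formula A}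
    (hχ : ∀ v (σ : Fin 2 → ℕ), σ v < w.length → f (σ v) ≠ 0 →
      (Sat w σ (χ v) ↔ ¬ (a ≤ σ v ∧ (σ v : ℤ) < e))) (o : Bool) (v : Fin 2) (σ : Fin 2 → ℕ)
    (hσ : σ v < w.length) (hf : f (σ v) ≠ 0) :
    Sat w σ (or (χ v) (ex (v + 1) (and (and (letter (q K) (v + 1))
        (or (eq (v + 1) v) (if o then lt (v + 1) v else lt v (v + 1)))) (neg (χ (v + 1)))))) ↔
      ¬ (a ≤ σ v ∧ (σ v : ℤ) < e ∧ ∀ z : ℤ, a ≤ z → z < e → f z = K →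
        if o then (σ v : ℤ) < z else z < σ v) := by
  have hv : v ≠ v + 1 := by fin_cases v <;> decide
  have hinner : ∀ i < w.length, (Sat w (Function.update σ (v + 1) i) (and (and (letter (q K) (v + 1))
        (or (eq (v + 1) v) (if o then lt (v + 1) v else lt v (v + 1)))) (neg (χ (v + 1)))) ↔
      (f i = K ∧ (if o then i ≤ σ v else σ v ≤ i)) ∧ a ≤ i ∧ (i : ℤ) < e) := by
    intro i hi
    have h1 := hw i hi
    have hlet : w[i]? = some (q K) ↔ f i = K := by
      rw [h1.1]
      exact ⟨fun h => hq _ _ h1.2 hKm (Option.some.inj h), fun h => by rw [h]⟩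
    have hord : Sat w (Function.update σ (v + 1) i)
        (or (eq (v + 1) v) (if o then lt (v + 1) v else lt v (v + 1))) ↔
          if o then i ≤ σ v else σ v ≤ i := by
      cases o <;> simp [Sat] <;> omega
    change ((w[Function.update σ (v + 1) i (v + 1)]? = some (q K) ∧ Sat w _ (or _ _)) ∧ ¬ Sat w _ _) ↔ _
    rw [Function.update_self, hlet, hord]
    refine and_congr_right fun hfi => ?_
    have := hχ (v + 1) (Function.update σ (v + 1) i) (by simpa using hi) (by
      rw [Function.update_self, hfi.1]; exact hK)
    rw [Function.update_self] at this
    rw [this, not_not]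
  rw [Sat, hχ v σ hσ hf, Sat, ← not_iff_not, not_or, not_not, not_not, and_assoc]
  refine and_congr_right fun h1 => and_congr_right fun h2 => ?_
  constructor
  · intro h z hz1 hz2 hz
    lift z to ℕ using by omega
    by_contra hc
    refine h ⟨z, by omega, (hinner z (by omega)).2 ⟨⟨hz, ?_⟩, hz1, hz2⟩⟩
    cases o <;> simp at hc ⊢ <;> omega
  · rintro h ⟨i, hi, hs⟩
    obtain ⟨⟨h3, h4⟩, h5, h6⟩ := (hinner i hi).1 hs
    have := h i h5 h6 h3
    cases o <;> simp at this h4 <;> omega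

/-- The marker `k + 2` does not occur inside its shell and is the letter of the shell nearest to the
inside. Padding next to the border may be classified wrongly, so only positions with a nonzero
letter are considered; the sentence looks at no others. -/
theorem sat_outer (hq : ∀ e e', e ≤ m → e' ≤ m → q e = q e' → e = e')
    (hw : ∀ i < w.length, w[i]? = some (q (f i)) ∧ f i ≤ m) (hT : 1 ≤ T) :
    ∀ (k N : ℕ) (o : Bool) (χ : Fin 2 → Formula A) (a e : ℤ), k + 1 ≤ m → 1 ≤ N → 0 ≤ a →
      e ≤ w.length → (Seg n f a (if o then nest T b k N else (nest T b k N).reverse)) →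
      e = a + segLen n (nest T b k N) → (∀ v (σ : Fin 2 → ℕ), σ v < w.length → f (σ v) ≠ 0 →
        (Sat w σ (χ v) ↔ ¬ (a ≤ σ v ∧ (σ v : ℤ) < e))) →
      ∃ a' e' : ℤ, 0 ≤ a' ∧ e' ≤ w.length ∧ Seg n f a' (nest T b 0 0) ∧
        e' = a' + segLen n (nest T b 0 0) ∧ ∀ v (σ : Fin 2 → ℕ), σ v < w.length → f (σ v) ≠ 0 →
          (Sat w σ (outer q k o χ v) ↔ ¬ (a' ≤ σ v ∧ (σ v : ℤ) < e')) := by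
  intro k
  induction k with
  | zero =>
    intro N o χ a e _ _ ha he hs hae hχ
    refine ⟨a, e, ha, he, ?_, hae, hχ⟩
    cases o <;> cases b <;> simpa [nest] using hs
  | succ k ih =>
    intro N o χ a e hk hN ha he hs hae hχ
    have hlen := segLen_nonneg n (nest T b k (2 * T))
    obtain ⟨N, rfl⟩ : ∃ N', N = N' + 1 := ⟨N - 1, by omega⟩
    rw [nest, segLen_append, segLen_reverse] at hae
    have hcop : (6 * n + 7 : ℤ) ≤ segLen n (copies (N + 1) (alphabetWord (k + 2))) :=
      le_segLen _ (by simp [copies_succ, alphabetWord])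
    cases o with
    | true =>
      rw [if_pos rfl, nest, seg_append, segLen_reverse] at hs
      have hK := hs.2
      rw [copies_succ, alphabetWord, List.cons_append, Seg] at hK
      refine ih (2 * T) false _ a (a + segLen n (nest T b k (2 * T))) (by omega) (by omega) ha
        (by omega) hs.1 rfl fun v σ hσ hf => ?_
      rw [sat_step hq hw (by omega) (by omega) ha he hχ true v σ hσ hf, not_iff_not]
      simp only [if_true]
      constructor
      · rintro ⟨h1, h2, h3⟩
        have h4 := h3 _ (by omega) (by omega) hK.1.1
        -- A position before the first marker but past the inner segment would be padding.
        refine ⟨h1, not_le.1 fun h5 => hf (hs.2.eq_zero h5 (by omega) (by omega))⟩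
      · rintro ⟨h1, h2⟩
        refine ⟨h1, by omega, fun z hz1 hz2 hz => ?_⟩
        by_contra h3
        have := hs.1.le (fun e he => (mem_nest (List.mem_reverse.1 he)).2) hz1
          (by rw [segLen_reverse]; omega)
        omega
    | false =>
      rw [if_neg (by simp), nest, List.reverse_append, List.reverse_reverse, seg_append,
        segLen_reverse] at hs
      have hK := hs.1
      rw [copies_succ, alphabetWord, List.reverse_append, List.reverse_cons, ← List.append_assoc,
        seg_append] at hK
      have hX : segLen n ((copies N (alphabetWord (k + 2))).reverse ++
          (List.range' 1 (k + 2 - 1)).reverse) + (6 * n + 7) =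
            segLen n (copies (N + 1) (alphabetWord (k + 2))) := by
        rw [copies_succ, alphabetWord]
        simp only [segLen_append, segLen_reverse, segLen_cons]
        ring
      rw [alphabetWord] at hX hcop hs hae
      refine ih (2 * T) true _ (a + segLen n (copies (N + 1) (alphabetWord (k + 2)))) e (by omega)
        (by omega) (by rw [alphabetWord]; omega) he hs.2 (by rw [alphabetWord]; omega)
        fun v σ hσ hf => ?_
      rw [sat_step hq hw (by omega) (by omega) ha he hχ false v σ hσ hf, not_iff_not, alphabetWord]
      simp only [Bool.false_eq_true, if_false]
      constructor
      · rintro ⟨h1, h2, h3⟩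
        have h4 := h3 _ (by omega) (by omega) hK.2.1.1
        refine ⟨not_lt.1 fun h5 => hf (hs.1.eq_zero h1 (by rw [segLen_reverse]; omega) (Or.inr ?_)),
          h2⟩
        rw [segLen_reverse]
        omega
      · rintro ⟨h1, h2⟩
        refine ⟨by omega, h2, fun z hz1 hz2 hz => ?_⟩
        by_contra h3
        have := hs.2.le (fun e he => (mem_nest he).2) (y := z) (by omega) (by omega)
        omega

end Semantics

/-! ### The finite words and the strictness of the hierarchy -/

open Formula

/-- The padded list: every letter in the middle of a block of `6 * n + 7` positions. -/
def padded (n : ℕ) : List ℕ → List ℕ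
  | [] => []
  | e :: c => List.replicate (3 * n + 3) 0 ++ e :: (List.replicate (3 * n + 3) 0 ++ padded n c)

theorem length_padded (n : ℕ) (c : List ℕ) : ((padded n c).length : ℤ) = segLen n c := by
  induction c with
  | nil => simp [padded]
  | cons e c ih => simp [padded, ih]; ring

theorem mem_padded {n e : ℕ} {c : List ℕ} (h : e ∈ padded n c) : e = 0 ∨ e ∈ c := by
  induction c with
  | nil => simp [padded] at h
  | cons e' c ih =>
    simp only [padded, List.mem_append, List.mem_cons, List.mem_replicate] at h ⊢
    tauto

theorem seg_padded {n : ℕ} {f : ℤ → ℕ} (c : List ℕ) : ∀ {a : ℤ},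
    (∀ i < (padded n c).length, (padded n c)[i]? = some (f (a + i))) → Seg n f a c := by
  induction c with
  | nil => intros; trivial
  | cons e c ih =>
    intro a h
    have hlen : (padded n (e :: c)).length = 6 * n + 7 + (padded n c).length := by
      simp [padded]; ring
    rw [hlen] at h
    refine ⟨⟨?_, fun t h0 ht => ?_⟩, ih fun i hi => ?_⟩
    · have := h (3 * n + 3) (by omega)
      simp [padded] at this
      exact this.symm
    · rw [abs_le] at ht
      obtain ⟨i, hi⟩ : ∃ i : ℕ, (i : ℤ) = 3 * n + 3 + t := ⟨(3 * n + 3 + t).toNat, by omega⟩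
      have := h i (by omega)
      rw [hi, ← add_assoc] at this
      refine (Option.some.inj ?_).symm
      rw [← this]
      rcases lt_or_ge t 0 with ht0 | ht0
      · rw [padded, List.getElem?_append_left (by simp; omega), List.getElem?_replicate,
          if_pos (by omega)]
      · rw [padded, List.getElem?_append_right (by simp; omega), List.length_replicate,
          List.getElem?_cons, if_neg (by omega),
          List.getElem?_append_left (by simp; omega), List.getElem?_replicate, if_pos (by omega)]
    · have := h (6 * n + 7 + i) (by omega)
      rw [show a + (6 * n + 7) + i = a + ((6 * n + 7 + i : ℕ) : ℤ) by push_cast; ring, ← this, padded,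
        List.getElem?_append_right (by simp; omega), List.length_replicate, List.getElem?_cons,
        if_neg (by omega), List.getElem?_append_right (by simp; omega), List.length_replicate]
      congr 1
      omega

/-- The two families of words, over the letters `0, …, k + 1`. -/
def hierarchyList (k n : ℕ) (b : Bool) : List ℕ :=
  0 :: padded n (nest (richness n) b k (richness n))

/-- The letters of a list, and the letter `e` outside of it. -/
def letterFun (e : ℕ) (x : List ℕ) (y : ℤ) : ℕ := (letterAt x y).getD e

theorem letterFun_of_lt {e : ℕ} {x : List ℕ} {i : ℕ} (hi : i < x.length) :
    x[i]? = some (letterFun e x i) := by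
  simp [letterFun, letterAt_natCast, hi]

section

variable {k n : ℕ} {b : Bool}

theorem mem_hierarchyList {e : ℕ} (h : e ∈ hierarchyList k n b) : e ≤ k + 1 := by
  rcases List.mem_cons.1 h with rfl | h
  · omega
  · rcases mem_padded h with rfl | h
    · omega
    · exact (mem_nest h).2

theorem length_hierarchyList : ((hierarchyList k n b).length : ℤ) =
    1 + segLen n (nest (richness n) b k (richness n)) := by
  rw [hierarchyList, List.length_cons, ← length_padded]; push_cast; ring

theorem letterFun_le {i : ℕ} (hi : i < (hierarchyList k n b).length) (e : ℕ) :
    letterFun e (hierarchyList k n b) i ≤ k + 1 :=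
  mem_hierarchyList (List.mem_of_getElem? (letterFun_of_lt hi))

theorem letterFun_outside {x : List ℕ} {e : ℕ} {y : ℤ} (h : y < 0 ∨ x.length ≤ y) :
    letterFun e x y = e := by
  rcases h with h | h
  · simp [letterFun, letterAt, not_le.2 h]
  · lift y to ℕ using by omega
    rw [letterFun, letterAt_natCast, List.getElem?_eq_none (by omega)]; rfl

theorem seg_hierarchyList (e : ℕ) {a : ℤ} {f : ℤ → ℕ}
    (hf : ∀ x, f (a + x) = letterFun e (hierarchyList k n b) (1 + x)) :
    Seg n f a (nest (richness n) b k (richness n)) := by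
  refine seg_padded _ fun i hi => ?_
  have := letterFun_of_lt (e := e) (x := hierarchyList k n b) (i := i + 1) (by
    simp [hierarchyList]; omega)
  rw [hf, add_comm 1, ← Nat.cast_succ, ← this]
  simp [hierarchyList]

variable {A : Type*} {q : ℕ → A}

theorem models_hierarchySentence (hq : ∀ e e', e ≤ k + 1 → e' ≤ k + 1 → q e = q e' → e = e') :
    (hierarchySentence q k).Models ((hierarchyList k n b).map q) ↔ b = true := by
  set f := letterFun 0 (hierarchyList k n b) with hf
  have hw : ∀ i < ((hierarchyList k n b).map q).length,
      ((hierarchyList k n b).map q)[i]? = some (q (f i)) ∧ f i ≤ k + 1 := by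
    intro i hi
    rw [List.length_map] at hi
    rw [List.getElem?_map, letterFun_of_lt (e := 0) hi]
    exact ⟨rfl, letterFun_le hi 0⟩
  have hseg : Seg n f 1 (nest (richness n) b k (richness n)) :=
    seg_hierarchyList 0 fun _ => rfl
  have hrich : 1 ≤ richness n := richness_le (Nat.zero_le n)
  have hlen := length_hierarchyList (k := k) (n := n) (b := b)
  have hf0 : f 0 = 0 := by simp [hf, letterFun, letterAt, hierarchyList]
  obtain ⟨a, e, ha, he, hs, rfl, hχ⟩ := sat_outer hq hw hrich k (richness n) true
    (fun _ => falsum) 1 (1 + segLen n (nest (richness n) b k (richness n))) le_rfl hrich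
    (by omega) (by rw [List.length_map, hlen]) (by simpa using hseg) rfl (by
      intro v σ hσ hfσ
      have : σ v ≠ 0 := fun h => hfσ (by rw [h]; exact hf0)
      rw [List.length_map] at hσ
      simp only [Sat, false_iff, not_not]
      omega)
  have hinner : ∀ i < ((hierarchyList k n b).map q).length,
      (Sat ((hierarchyList k n b).map q) (Function.update (fun _ => 0) 0 i)
        (and (letter (q 1) 0) (neg (outer q k true (fun _ => falsum) 0))) ↔
      f i = 1 ∧ a ≤ i ∧ (i : ℤ) < a + segLen n (nest (richness n) b 0 0)) := by
    intro i hi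
    rw [Sat, Sat, Sat, Function.update_self, (hw i hi).1]
    have hlet : some (q (f i)) = some (q 1) ↔ f i = 1 :=
      ⟨fun h => hq _ _ (hw i hi).2 (by omega) (Option.some.inj h), fun h => by rw [h]⟩
    rw [hlet]
    refine and_congr_right fun h1 => ?_
    have := hχ 0 (Function.update (fun _ => 0) 0 i) (by simpa using hi) (by
      rw [Function.update_self, h1]; decide)
    rw [this, not_not, Function.update_self]
  constructor
  · rintro ⟨i, hi, hsat⟩
    have := (hinner i hi).1 hsat
    by_contra hb
    simp [nest, hb] at this
    omega
  · rintro rfl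
    have hl1 : segLen n (nest (richness n) true 0 0) = 6 * n + 7 := by simp [nest]
    rw [hl1] at he
    obtain ⟨i, hi⟩ : ∃ i : ℕ, (i : ℤ) = a + (3 * n + 3) := ⟨(a + (3 * n + 3)).toNat, by omega⟩
    refine ⟨i, by omega, (hinner i (by omega)).2 ⟨?_, by omega, by rw [hl1]; omega⟩⟩
    rw [hi]
    exact hs.1.1

theorem sim_hierarchyList (b b' : Bool) :
    Sim k n (fun x y => letterFun (k + 2) (hierarchyList k n b) x =
      letterFun (k + 2) (hierarchyList k n b') y) 0 0 := by
  set F := letterFun (k + 2) (hierarchyList k n b) with hF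
  set G := letterFun (k + 2) (hierarchyList k n b') with hG
  -- The leading `0` of the words gives the pebbles a common starting position outside of the
  -- segments.
  have h0 : F 0 = G 0 := by simp [hF, hG, letterFun, letterAt, hierarchyList]
  cases k with
  | zero => simpa [Sim] using h0
  | succ k =>
    have hlen := length_hierarchyList (k := k + 1) (n := n) (b := b)
    have hlen' := length_hierarchyList (k := k + 1) (n := n) (b := b')
    have hsim := sim_nest n k (richness n) b b' (fun x => F (1 + x)) (fun x => G (1 + x)) _ _ le_rfl
      (seg_hierarchyList (k + 1 + 2) fun x => by rw [zero_add])
      (seg_hierarchyList (k + 1 + 2) fun x => by rw [zero_add]) rfl rfl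
      (fun y hy => by
        rcases eq_or_ne y (-1) with rfl | h1
        · simpa using h0
        · simp only [hF, hG]
          rw [letterFun_outside (by omega), letterFun_outside (by omega)])
      (fun t ht => by
        simp only [hF, hG]
        rw [letterFun_outside (by omega), letterFun_outside (by omega)])
      n le_rfl (-1) (-1) (Or.inl ⟨by omega, rfl⟩)
    -- Two reflections compose to the translation by one that undoes the shift by the leading `0`.
    have h1 := Sim.reflect (R := fun x y => F (-x) = G (-y)) (a := -1) (b := -1)
      (hsim.weaken fun x y h => by
        rw [show -(-1 - x) = 1 + x by ring, show -(-1 - y) = 1 + y by ring]; exact h.1)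
    have h2 := Sim.reflect (R := fun x y => F x = G y) (a := 0) (b := 0)
      (h1.weaken fun x y h => by rw [zero_sub, zero_sub]; exact h)
    simpa using h2

/-- The default `k + 2` exceeds all letters, so it recognises the positions outside of the word. -/
theorem letterAt_hierarchyList (x : ℤ) : letterAt ((hierarchyList k n b).map q) x =
    if letterFun (k + 2) (hierarchyList k n b) x = k + 2 then none
      else some (q (letterFun (k + 2) (hierarchyList k n b) x)) := by
  by_cases hx : x < 0 ∨ (hierarchyList k n b).length ≤ x
  · rw [if_pos (letterFun_outside hx)]
    rcases hx with hx | hx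
    · simp [letterAt, hx]
    · lift x to ℕ using by omega
      rw [letterAt_natCast, List.getElem?_eq_none (by rw [List.length_map]; omega)]
  · push Not at hx
    lift x to ℕ using hx.1
    have hi : x < (hierarchyList k n b).length := by omega
    have := letterFun_le hi (k + 2)
    rw [if_neg (by omega), letterAt_natCast, List.getElem?_map, letterFun_of_lt (e := k + 2) hi]
    rfl

theorem models_iff_of_blocks_le {ψ : Formula A} (hb : ψ.blocks ≤ k) (hd : ψ.depth ≤ n) :
    ψ.Models ((hierarchyList k n true).map q) ↔ ψ.Models ((hierarchyList k n false).map q) := by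
  refine sat_iff_of_config ψ (fun x y hxy => ?_)
    ⟨by simp [SameOrder], fun v => by simpa using sim_hierarchyList (k := k) (n := n) true false⟩
    ⟨by simp [SameOrder], fun v => ?_⟩ hd true hb
  · rw [letterAt_hierarchyList, letterAt_hierarchyList, hxy]
  · exact (sim_hierarchyList (k := k) (n := n) false true).weaken fun x y h => h.symm

end

theorem FO2m_mono {A : Type*} {m m' : ℕ} (h : m ≤ m') : FO2m A m ⊆ FO2m A m' := by
  intro φ hφ
  simp only [FO2m, Set.mem_iUnion] at hφ ⊢
  obtain ⟨n, -, hs, hb, hd⟩ := hφ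
  exact ⟨max n m', le_max_right _ _, hs, hb.trans h, hd.trans (le_max_left _ _)⟩

theorem exists_separates (k : ℕ) : ∃ φ ∈ FO2m (Fin (k + 2)) (k + 1), ∃ K L : Set (List (Fin (k + 2))),
    ((∀ w ∈ K, φ.Models w) ∧ ∀ w ∈ L, ¬ φ.Models w) ∧
      ¬ ∃ ψ ∈ FO2m (Fin (k + 2)) k, Separates ψ K L := by
  set q : ℕ → Fin (k + 2) := Fin.ofNat (k + 2)
  have hq : ∀ e e', e ≤ k + 1 → e' ≤ k + 1 → q e = q e' → e = e' := by
    intro e e' he he' h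
    have := congrArg Fin.val h
    simpa [q, Fin.ofNat, Nat.mod_eq_of_lt (Nat.lt_succ_of_le he),
      Nat.mod_eq_of_lt (Nat.lt_succ_of_le he')] using this
  -- The languages collect the words for all `n`, since a competing sentence may have any depth.
  refine ⟨hierarchySentence q k, ?_, Set.range fun n => (hierarchyList k n true).map q,
    Set.range fun n => (hierarchyList k n false).map q, ⟨?_, ?_⟩, ?_⟩
  · simp only [FO2m, Set.mem_iUnion]
    exact ⟨max (k + 1) (hierarchySentence q k).depth, le_max_left _ _,
      isSentence_hierarchySentence q k, blocks_hierarchySentence q k, le_max_right _ _⟩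
  · rintro _ ⟨n, rfl⟩
    exact (models_hierarchySentence hq).2 rfl
  · rintro _ ⟨n, rfl⟩ h
    simpa using (models_hierarchySentence hq).1 h
  · rintro ⟨ψ, hψ, hsep⟩
    simp only [FO2m, Set.mem_iUnion] at hψ
    obtain ⟨n, -, -, hb, hd⟩ := hψ
    have h := models_iff_of_blocks_le (q := q) hb hd
    rcases hsep with ⟨h1, h2⟩ | ⟨h1, h2⟩
    · exact h2 _ ⟨n, rfl⟩ (h.1 (h1 _ ⟨n, rfl⟩))
    · exact h2 _ ⟨n, rfl⟩ (h.2 (h1 _ ⟨n, rfl⟩))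

end TwoVar

theorem mainTheorem7 (m : ℕ) (hm : 1 ≤ m) :
    (∃ φ ∈ TwoVar.FO2m (Fin (m + 1)) m, ∃ K L : Set (List (Fin (m + 1))),
      TwoVar.Separates φ K L ∧
        ¬ ∃ ψ ∈ TwoVar.FO2m (Fin (m + 1)) (m - 1), TwoVar.Separates ψ K L) ∧
    TwoVar.definable (Fin (m + 1)) (m - 1) ⊂ TwoVar.definable (Fin (m + 1)) m := by
  obtain ⟨k, rfl⟩ : ∃ k, m = k + 1 := ⟨m - 1, by omega⟩
  obtain ⟨φ, hφ, K, L, hsep, hnot⟩ := TwoVar.exists_separates k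
  refine ⟨⟨φ, hφ, K, L, Or.inl hsep, hnot⟩, ?_, fun hsub => ?_⟩
  · rintro P ⟨ψ, hψ, rfl⟩
    exact ⟨ψ, TwoVar.FO2m_mono (Nat.sub_le _ _) hψ, rfl⟩
  · obtain ⟨ψ, hψ, hP⟩ := hsub ⟨φ, hφ, rfl⟩
    have heq : ∀ w, φ.Models w ↔ ψ.Models w := fun w => Set.ext_iff.1 hP w
    exact hnot ⟨ψ, hψ, Or.inl ⟨fun w hw => (heq w).1 (hsep.1 w hw),
      fun w hw h => hsep.2 w hw ((heq w).2 h)⟩⟩
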